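/- A \emph{3-permutation} of size $n$ is a pair $(\sigma,\tau)$ of permutations of $\{1,\dots,n\}$. It \emph{contains} a pattern $(\pi,\rho)$, where $\pi,\rho$ are permutations of $\{1,\dots,k\}$, if there are indices $i_1<\dots<i_k$ such that $\sigma(i_1)\cdots\sigma(i_k)$ is order-isomorphic to $\pi$ and, at the same indices, $\tau(i_1)\cdots\tau(i_k)$ is order-isomorphic to $\rho$; otherwise it \emph{avoids} the pattern. Let $Av_n((12,12),(312,231))$ be the set of 3-permutations of size $n$ avoiding both $(12,12)$ and $(312,231)$. For $1\le i\le n$ put $r_\sigma(i)=|\{j>i:\sigma(j)<\sigma(i)\}|$ and $l_\tau(i)=|\{j<i:\tau(j)>\tau(i)\}|$, and let $$\Gamma(\sigma,\tau)=\{(r_\sigma(i),l_\tau(i)) : 1\le i\le n\}\subset\mathbb{Z}^2 .$$ Let $S=\{(0,0),(1,0),(0,1)\}$ and let $A$ be a set of symbols with at least two elements. A rule $\mathcal{R}\subset A^S$ is \emph{TEP} (totally extremally permutive) if, for every $x\in S$, every map $S\setminus\{x\}\to A$ has exactly one extension to $S$ lying in $\mathcal{R}$. The \emph{Ledrappier}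 rule is the TEP rule with $A=\mathbb{Z}/2\mathbb{Z}$ and $\mathcal{R}=\{w : w(0,0)+w(1,0)+w(0,1)=0\}$. Let $T_n=\{(x,y)\in\mathbb{Z}^2 : x,y\ge 0,\ x+y<n\}$. Given a set $P\subset\mathbb{Z}^2$ and a coloring $c:P\to A$, one iteratively deduces symbols of further cells: whenever two cells of a translate of $S$ carry known symbols, the third cell gets the symbol completing a pattern of $\mathcal{R}$. The set $P$ is a \emph{basis} of $T_n$ for $\mathcal{R}$ if, for every coloring $c:P\to A$, this process yields a valid coloring of $T_n$: the cells reached are exactly those of $T_n$, each of them gets exactly one symbol (there is no conflict), and every translate of $S$ contained in $T_n$ carries a pattern of $\mathcal{R}$. \textbf{Theorem.} Let $n\ge 1$. Then $\Gamma$ restricts to a bijection from $Av_n((12,12),(312,231))$ onto the set of bases of $T_n$ for the Ledrappier rule. More generally, for every set $A$ with at least two elements and every TEP rule $\mathcal{R}\subset A^S$, $\Gamma$ restricts to a bijection from $Av_n((12,12),(312,231))$ onto the set of bases of $T_n$ for $\mathcal{R}$. -/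

import Mathlib

/-! ### 3-permutations and pattern avoidance -/

/-- A `3`-permutation of size `n`: a pair of permutations of an `n`-element linear order
(`Fin n` plays the role of `{1, …, n}`). -/
abbrev ThreePerm (n : ℕ) : Type := Equiv.Perm (Fin n) × Equiv.Perm (Fin n)

/-- `p` contains the pattern `q` if there are positions `e 0 < e 1 < ⋯ < e (k - 1)` at which
*both* components of `p` are in the same relative order as the corresponding components of `q`. -/
def ThreePerm.Contains {n k : ℕ} (p : ThreePerm n) (q : ThreePerm k) : Prop :=
  ∃ e : Fin k ↪o Fin n, ∀ a b : Fin k,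
    (p.1 (e a) < p.1 (e b) ↔ q.1 a < q.1 b) ∧ (p.2 (e a) < p.2 (e b) ↔ q.2 a < q.2 b)

/-- The permutation `312`, written on the letters `0, 1, 2`. -/
def perm312 : Equiv.Perm (Fin 3) := ⟨![2, 0, 1], ![1, 2, 0], by decide, by decide⟩

/-- The permutation `231`, written on the letters `0, 1, 2`. -/
def perm231 : Equiv.Perm (Fin 3) := ⟨![1, 2, 0], ![2, 0, 1], by decide, by decide⟩

/-- The pattern `(12, 12)`. -/
def pattern12 : ThreePerm 2 := (1, 1)

/-- The pattern `(312, 231)`. -/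
def pattern312 : ThreePerm 3 := (perm312, perm231)

/-- The set `Av_n((12,12), (312,231))`. -/
def avoiders (n : ℕ) : Set (ThreePerm n) :=
  {p | ¬ p.Contains pattern12 ∧ ¬ p.Contains pattern312}

/-! ### Inversion counts and the map `Γ` -/

/-- The number of right inversions of `σ` at `i`. -/
def rightInv {n : ℕ} (σ : Equiv.Perm (Fin n)) (i : Fin n) : ℕ :=
  (Finset.univ.filter fun j : Fin n => i < j ∧ σ j < σ i).card

/-- The number of left inversions of `σ` at `i`. -/
def leftInv {n : ℕ} (σ : Equiv.Perm (Fin n)) (i : Fin n) : ℕ :=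
  (Finset.univ.filter fun j : Fin n => j < i ∧ σ i < σ j).card

/-- `Γ(σ, τ)` is the (unlabelled) set of the points `(r_σ(i), l_τ(i))`. -/
def Gam {n : ℕ} (p : ThreePerm n) : Set (ℤ × ℤ) :=
  Set.range fun i : Fin n => ((rightInv p.1 i : ℤ), (leftInv p.2 i : ℤ))

/-! ### TEP rules on the three-cell window, deduction, and triangle bases -/

/-- The window `S = {(0,0), (1,0), (0,1)}`; a pattern on `S` with symbols in `A` is a function
`Fin 3 → A`, the value at `k` being the symbol in the cell `windowCell k`. -/
def windowCell : Fin 3 → ℤ × ℤ := ![(0, 0), (1, 0), (0, 1)]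

/-- A set `R` of allowed patterns is TEP (totally extremally permutive) if, however all cells of
the window but one are filled, exactly one symbol in the remaining cell gives an allowed
pattern. -/
def IsTEP {A : Type*} (R : Set (Fin 3 → A)) : Prop :=
  ∀ (k : Fin 3) (w : Fin 3 → A), ∃! a : A, Function.update w k a ∈ R

/-- The rule of the Ledrappier subshift: the three symbols of every window sum to `0` mod `2`. -/
def ledrappier : Set (Fin 3 → ZMod 2) := {w | w 0 + w 1 + w 2 = 0}

/-- The triangle `T_n`. -/
def triangle (n : ℕ) : Set (ℤ × ℤ) := {v | 0 ≤ v.1 ∧ 0 ≤ v.2 ∧ v.1 + v.2 < n}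

/-- `Deduces R c v a`: starting from the partial coloring `c : P → A`, the symbol `a` can be
deduced for the cell `v` by iterating the rules: whenever two cells of a translate of the window
carry known symbols, the third cell receives the symbol that completes an allowed pattern. -/
inductive Deduces {A : Type*} (R : Set (Fin 3 → A)) {P : Set (ℤ × ℤ)} (c : P → A) :
    ℤ × ℤ → A → Prop
  | base (v : P) : Deduces R c v (c v)
  | step (v : ℤ × ℤ) (k : Fin 3) (w : Fin 3 → A) (hw : w ∈ R)
      (h : ∀ j : Fin 3, j ≠ k → Deduces R c (v + windowCell j) (w j)) :
      Deduces R c (v + windowCell k) (w k)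

/-- `t` is a valid coloring of the set of cells `D` (only its values on `D` matter): every
translate of the window inside `D` carries an allowed pattern. -/
def IsValidOn {A : Type*} (R : Set (Fin 3 → A)) (D : Set (ℤ × ℤ)) (t : ℤ × ℤ → A) : Prop :=
  ∀ v : ℤ × ℤ, (∀ k : Fin 3, v + windowCell k ∈ D) → (fun k => t (v + windowCell k)) ∈ R

/-- `P` is a basis of `T_n` for the rule `R`: for every coloring of `P`, iterated deduction gives
a valid coloring of `T_n`, i.e. the deduced cells are exactly those of `T_n`, each of them gets
exactly one symbol (no conflict), and the result is valid. -/
def IsTriangleBasis {A : Type*} (R : Set (Fin 3 → A)) (n : ℕ) (P : Set (ℤ × ℤ)) : Prop :=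
  ∀ c : P → A, ∃ t : ℤ × ℤ → A, IsValidOn R (triangle n) t ∧
    ∀ (v : ℤ × ℤ) (a : A), Deduces R c v a ↔ v ∈ triangle n ∧ a = t v

/-!
Read a `3`-permutation `(σ, τ)` as three linear orders on the positions: the natural one, the order
by `σ`, and the order by `τ`. Avoiding `(12, 12)` means that no pair is unanimous, that is, ordered
in the same way by all three, and avoiding `(312, 231)` means that no triple is ordered `abc`,
`bca`, `cab` by the three orders. Both conditions are invariant under cyclic rotation of the orders.
The coordinates of a point of `Γ`, completed to barycentric
coordinates of the triangle `T_n`, count for each cyclically consecutive pair of orders the elements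
that are above in one and below in the other; so the symmetry of the orders becomes the rotational
symmetry of the triangle.

Both sides of the bijection are described by one recursive structure, `Builds`: a finite set builds
a triangle if the triangle arises from the single cells by repeatedly merging two disjoint touching
triangles. Up to rotation, such a merge puts one triangle in a corner and the other on the opposite
side.

* *Bases are the sets that build `T_n`*, whatever the rule. Configurations on two triangles of a
  merge glue to a configuration of the plane, since a configuration can be prescribed on one row and
  at one cell of every lower row (`IsTEP.exists_isConfig`); hence the symbols on a building set are
  free, and they determine the rest (`Builds.isTriangleBasis`). Conversely, merge parts of a
  basis as long as possible. Intersecting triangles would give a conflict, so at the end the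
  triangles are pairwise apart, their union is closed under deduction, and connectedness of `T_n`
  leaves a single one (`IsTriangleBasis.exists_builds`).

* *Images of avoiders build `T_n`.* A merge corresponds to a splitting of the three orders into two
  parts separated in opposite ways by two of the orders, such that the second part is inserted as a
  block into the third order. The central fact `IsTriOrder.exists_isSplitting` says that a splitting
  exists. If the graph of pairs on which two of the orders agree is disconnected, the component of
  an extremal element is the second part. That the three graphs cannot all be connected follows by
  induction, removing the smallest element of one order.

* *Every set that builds `T_n` is the image of exactly one avoider.* Splittings preserve both
  avoidance conditions (`IsSplitting.isTriOrder`), so the three orders can be assembled along the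
  merges (`Builds.exists_isReading`). They are forced: the inversion counts of the points of the
  corner triangle are so large that these points must come first in one order and last in another
  (`IsMerge.isSplitting`, `Builds.order_unique`).
-/

/-! ### Three linear orders: splitting off a module -/

/-- The total orders pulled back along `f` and `g` agree on the pair `p, q`. -/
def AgreeAt {X : Type*} (f g : X → ℕ) (p q : X) : Prop :=
  (f p < f q ∧ g p < g q) ∨ (f q < f p ∧ g q < g p)

/-- The graph on `S` joining the pairs on which `f` and `g` agree is connected, stated as: every
nontrivial cut of `S` is crossed by an edge. -/
def AgreeConnected {X : Type*} (f g : X → ℕ) (S : Finset X) : Prop :=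
  ∀ T : X → Prop, (∃ p ∈ S, T p) → (∃ q ∈ S, ¬ T q) →
    ∃ p ∈ S, ∃ q ∈ S, T p ∧ ¬ T q ∧ AgreeAt f g p q

/-- Three orders on `S`, given by ranking functions, such that no pair is ordered the same way by
all three, and no triple is ordered `abc` by `f`, `bca` by `g` and `cab` by `h`. -/
structure IsTriOrder {X : Type*} (f g h : X → ℕ) (S : Finset X) : Prop where
  injf : Set.InjOn f S
  injg : Set.InjOn g S
  injh : Set.InjOn h S
  not_unanimous : ∀ p ∈ S, ∀ q ∈ S, ¬ (f p < f q ∧ g p < g q ∧ h p < h q)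
  not_cyclic : ∀ a ∈ S, ∀ b ∈ S, ∀ c ∈ S,
    ¬ ((f a < f b ∧ f b < f c) ∧ (g b < g c ∧ g c < g a) ∧ (h c < h a ∧ h a < h b))

/-- `S` splits into nonempty parts `S₁`, `S₂` with `S₁` below `S₂` for `f`, above `S₂` for `g`, and
such that no element of `S₁` lies between two elements of `S₂` for `h`. -/
structure IsSplitting {X : Type*} (f g h : X → ℕ) (S S₁ S₂ : Finset X) : Prop where
  nonempty₁ : S₁.Nonempty
  nonempty₂ : S₂.Nonempty
  mem_iff : ∀ p, p ∈ S ↔ p ∈ S₁ ∨ p ∈ S₂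
  lt_f : ∀ p ∈ S₁, ∀ q ∈ S₂, f p < f q
  lt_g : ∀ p ∈ S₁, ∀ q ∈ S₂, g q < g p
  module_h : ∀ p ∈ S₁, (∀ q ∈ S₂, h p < h q) ∨ (∀ q ∈ S₂, h q < h p)

lemma IsTriOrder.rotate {X : Type*} {f g h : X → ℕ} {S : Finset X} (H : IsTriOrder f g h S) :
    IsTriOrder g h f S where
  injf := H.injg
  injg := H.injh
  injh := H.injf
  not_unanimous p hp q hq := by
    have := H.not_unanimous p hp q hq
    tauto
  not_cyclic a ha b hb c hc := by
    have := H.not_cyclic c hc a ha b hb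
    tauto

lemma IsTriOrder.mono {X : Type*} {f g h : X → ℕ} {S S' : Finset X} (H : IsTriOrder f g h S)
    (hS : S' ⊆ S) : IsTriOrder f g h S' where
  injf := H.injf.mono (by exact_mod_cast hS)
  injg := H.injg.mono (by exact_mod_cast hS)
  injh := H.injh.mono (by exact_mod_cast hS)
  not_unanimous p hp q hq := H.not_unanimous p (hS hp) q (hS hq)
  not_cyclic a ha b hb c hc := H.not_cyclic a (hS ha) b (hS hb) c (hS hc)

/-- If the agreement graph of `f` and `g` is disconnected, the connected component of the
`f`-largest element is the second part of a splitting. -/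
lemma exists_isSplitting_of_not_agreeConnected {X : Type*} {f g h : X → ℕ} {S : Finset X}
    (H : IsTriOrder f g h S) (hc : ¬ AgreeConnected f g S) :
    ∃ S₁ S₂, IsSplitting f g h S S₁ S₂ := by
  classical
  unfold AgreeConnected at hc
  push Not at hc
  obtain ⟨T, ⟨p₀, hp₀, hTp₀⟩, ⟨q₀, hq₀, hTq₀⟩, hT⟩ := hc
  obtain ⟨M, hM, hmax⟩ := S.exists_max_image f ⟨p₀, hp₀⟩
  have symm : ∀ p q, AgreeAt f g p q → AgreeAt f g q p := fun p q h => by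
    unfold AgreeAt at *; tauto
  -- `C` is the connected component of `M`, the intersection of all closed sets containing `M`.
  let Cl : (X → Prop) → Prop := fun T => ∀ p ∈ S, ∀ q ∈ S, T p → AgreeAt f g p q → T q
  let C := S.filter fun c => ∀ T, Cl T → T M → T c
  have hCS : ∀ c ∈ C, c ∈ S := fun c hc => (Finset.mem_filter.1 hc).1
  have hMC : M ∈ C := Finset.mem_filter.2 ⟨hM, fun T _ h => h⟩
  have hCmin : ∀ T, Cl T → T M → ∀ c ∈ C, T c := fun T h1 h2 c hc =>
    (Finset.mem_filter.1 hc).2 T h1 h2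
  have hCcl : ∀ p ∈ C, ∀ q ∈ S, AgreeAt f g p q → q ∈ C := fun p hp q hq hpq =>
    Finset.mem_filter.2 ⟨hq, fun T h1 h2 => h1 p (hCS p hp) q hq (hCmin T h1 h2 p hp) hpq⟩
  have hne : ∃ d ∈ S, d ∉ C := by
    by_cases hTM : T M
    · refine ⟨q₀, hq₀, fun hC => hTq₀ (hCmin T ?_ hTM q₀ hC)⟩
      intro p hp q hq h1 h2
      by_contra h3
      exact hT p hp q hq h1 h3 h2
    · refine ⟨p₀, hp₀, fun hC => hCmin (fun x => ¬ T x) ?_ hTM p₀ hC hTp₀⟩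
      intro p hp q hq h1 h2 h3
      exact hT q hq p hp h3 h1 (symm _ _ h2)
  -- An agreeing pair of `C` cannot straddle an outside element `d` for `f`, since `f` and `g`
  -- disagree between `d` and `C`; so the elements of `C` above `d` form a closed set through `M`.
  have hfC : ∀ d ∈ S, d ∉ C → ∀ c ∈ C, f d < f c := by
    intro d hd hdC
    have key : ∀ c ∈ C, c ∈ C ∧ f d < f c := by
      apply hCmin (fun c => c ∈ C ∧ f d < f c)
      · rintro p hp q hq ⟨hpC, hdp⟩ hpq
        have hqC := hCcl p hpC q hq hpq
        refine ⟨hqC, ?_⟩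
        have h1 : ¬ AgreeAt f g p d := fun h => hdC (hCcl p hpC d hd h)
        have h2 : ¬ AgreeAt f g q d := fun h => hdC (hCcl q hqC d hd h)
        have h3 : f d ≠ f q := fun h => hdC (H.injf hd hq h ▸ hqC)
        have h4 : g d ≠ g q := fun h => hdC (H.injg hd hq h ▸ hqC)
        have h5 : g d ≠ g p := fun h => hdC (H.injg hd hp h ▸ hpC)
        unfold AgreeAt at h1 h2 hpq
        omega
      · refine ⟨hMC, lt_of_le_of_ne (hmax d hd) fun h => hdC (H.injf hd hM h ▸ hMC)⟩
    exact fun c hc => (key c hc).2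
  have hgC : ∀ d ∈ S, d ∉ C → ∀ c ∈ C, g c < g d := by
    intro d hd hdC c hcC
    have h1 : ¬ AgreeAt f g c d := fun h => hdC (hCcl c hcC d hd h)
    have h4 : g d ≠ g c := fun h => hdC (H.injg hd (hCS c hcC) h ▸ hcC)
    have := hfC d hd hdC c hcC
    unfold AgreeAt at h1
    omega
  refine ⟨S \ C, C, ?_, ⟨M, hMC⟩, ?_, ?_, ?_, ?_⟩
  · obtain ⟨d, hd, hdC⟩ := hne
    exact ⟨d, Finset.mem_sdiff.2 ⟨hd, hdC⟩⟩
  · intro p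
    have := hCS p
    simp only [Finset.mem_sdiff]
    tauto
  · intro p hp q hq
    exact hfC p (Finset.mem_sdiff.1 hp).1 (Finset.mem_sdiff.1 hp).2 q hq
  · intro p hp q hq
    exact hgC p (Finset.mem_sdiff.1 hp).1 (Finset.mem_sdiff.1 hp).2 q hq
  · intro d hd
    obtain ⟨hd, hdC⟩ := Finset.mem_sdiff.1 hd
    -- An agreeing pair of `C` separated by `d` for `h` would form a forbidden triple with `d`.
    have cross : ∀ q ∈ C, ∀ q' ∈ C, h q' < h d → h d < h q → ¬ AgreeAt f g q q' := by
      intro q hq q' hq' h1 h2 h3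
      have e1 := H.not_cyclic d hd q (hCS q hq) q' (hCS q' hq')
      have e2 := H.not_unanimous q' (hCS q' hq') q (hCS q hq)
      have := hfC d hd hdC q hq
      have := hgC d hd hdC q' hq'
      unfold AgreeAt at h3
      omega
    have hneh : ∀ q ∈ C, h d ≠ h q := fun q hq e => hdC (H.injh hd (hCS q hq) e ▸ hq)
    rcases lt_or_gt_of_ne (hneh M hMC) with hlt | hlt
    · left
      have key : ∀ c ∈ C, c ∈ C ∧ h d < h c := by
        apply hCmin (fun c => c ∈ C ∧ h d < h c) _ ⟨hMC, hlt⟩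
        rintro p hp q hq ⟨hpC, hdp⟩ hpq
        have hqC := hCcl p hpC q hq hpq
        refine ⟨hqC, ?_⟩
        by_contra hn
        exact cross p hpC q hqC (lt_of_le_of_ne (not_lt.1 hn) (hneh q hqC).symm) hdp hpq
      exact fun c hc => (key c hc).2
    · right
      have key : ∀ c ∈ C, c ∈ C ∧ h c < h d := by
        apply hCmin (fun c => c ∈ C ∧ h c < h d) _ ⟨hMC, hlt⟩
        rintro p hp q hq ⟨hpC, hdp⟩ hpq
        have hqC := hCcl p hpC q hq hpq
        refine ⟨hqC, ?_⟩
        by_contra hn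
        exact cross q hqC p hpC hdp (lt_of_le_of_ne (not_lt.1 hn) (hneh q hqC)) (symm _ _ hpq)
      exact fun c hc => (key c hc).2

/-! ### Three connected agreement graphs are impossible -/

/-! In the next lemmas `v` is the `f`-smallest element of `S`, all three agreement graphs on `S` are
connected, and `S` without `v` splits into `X₁` and `X₂`. Connectedness makes `v` adjacent to both
parts in the graph of the two orders in which the parts are separated. -/

section Extension

variable {X : Type*} {f g h : X → ℕ} {S X₁ X₂ : Finset X} {v : X}

lemma AgreeAt.symm {f g : X → ℕ} {p q : X} (H : AgreeAt f g p q) : AgreeAt f g q p := by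
  unfold AgreeAt at *; tauto

/-- If removing `v` disconnects an agreement graph, then `v` is adjacent to every part that is
closed in the remaining graph. -/
lemma AgreeConnected.exists_agreeAt {f g : X → ℕ} (hc : AgreeConnected f g S) (T : X → Prop)
    (hT : ∃ p ∈ S, T p) (hv : v ∈ S) (hvT : ¬ T v)
    (hcl : ∀ p ∈ S, ∀ q ∈ S, T p → ¬ T q → q ≠ v → ¬ AgreeAt f g p q) :
    ∃ p ∈ S, T p ∧ AgreeAt f g v p := by
  obtain ⟨p, hp, q, hq, hTp, hTq, hpq⟩ := hc T hT ⟨v, hv, hvT⟩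
  by_cases e : q = v
  · subst e
    exact ⟨p, hp, hTp, hpq.symm⟩
  · exact absurd hpq (hcl p hp q hq hTp hTq e)

/-- If the parts are separated for `f` and `g`, then either `v` is isolated in the graph of `f` and
`h`, or `X₁` is closed in the graph of `g` and `h`. -/
lemma false_of_isSplitting_min_fg (H : IsTriOrder f g h S) (hfg : AgreeConnected f g S)
    (hgh : AgreeConnected g h S)
    (hhf : AgreeConnected h f S) (hv : v ∈ S) (hmin : ∀ p ∈ S, p ≠ v → f v < f p)
    {S' : Finset X} (hS' : ∀ p, p ∈ S' ↔ p ∈ S ∧ p ≠ v)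
    (D : IsSplitting f g h S' X₁ X₂) : False := by
  obtain ⟨⟨x₁, hx₁⟩, ⟨x₂, hx₂⟩, hmem, hf, hg, hh⟩ := D
  have mS : ∀ p, p ∈ X₁ ∨ p ∈ X₂ → p ∈ S ∧ p ≠ v := fun p hp => (hS' p).1 ((hmem p).2 hp)
  have cS : ∀ p ∈ S, p = v ∨ p ∈ X₁ ∨ p ∈ X₂ := by grind
  have ig := H.injg
  have ih := H.injh
  have nu := H.not_unanimous
  simp only [Set.InjOn, Finset.mem_coe] at ig ih
  obtain ⟨p, hp, hp1, hvp⟩ := hfg.exists_agreeAt (v := v) (· ∈ X₁) ⟨x₁, by grind⟩ hv (by grind)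
    (by intro p hp q hq h1 h2 h3; unfold AgreeAt; grind)
  obtain ⟨q, hq, hq2, hvq⟩ := hfg.exists_agreeAt (v := v) (· ∈ X₂) ⟨x₂, by grind⟩ hv (by grind)
    (by intro p hp q hq h1 h2 h3; unfold AgreeAt; grind)
  unfold AgreeAt at hvp hvq
  have hg1 : ∀ p ∈ X₁, g v < g p := by grind
  have hh1 : ∀ p ∈ X₁, h p < h v := by grind
  -- If `X₂` is not above `X₁` for `h`, then `v` is the `h`-largest element.
  by_cases hup : ∃ p ∈ X₁, h x₂ < h p
  · obtain ⟨a, ha, hab⟩ := hup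
    have hh2 : ∀ p ∈ X₂, h p < h v := by grind
    obtain ⟨p, hp, q, hq, h1, h2, h3⟩ := hhf (· = v) ⟨v, hv, rfl⟩ ⟨x₁, by grind⟩
    unfold AgreeAt at h3
    grind
  · have hh2 : ∀ p ∈ X₁, ∀ q ∈ X₂, h p < h q := by grind
    obtain ⟨p, hp, q, hq, h1, h2, h3⟩ := hgh (· ∈ X₁) ⟨x₁, by grind⟩ ⟨v, by grind⟩
    unfold AgreeAt at h3
    grind

/-- If the parts are separated for `h` and `f`, then splitting `X₁ ∪ {v}` as well leads to a
disconnected agreement graph on `S`. -/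
lemma false_of_isSplitting_min_hf {W Y₁ Y₂ : Finset X} (H : IsTriOrder f g h S)
    (hfg : AgreeConnected f g S) (hgh : AgreeConnected g h S)
    (hhf : AgreeConnected h f S) (hv : v ∈ S) (hmin : ∀ p ∈ S, p ≠ v → f v < f p)
    {S' : Finset X} (hS' : ∀ p, p ∈ S' ↔ p ∈ S ∧ p ≠ v)
    (D : IsSplitting h f g S' X₁ X₂) (hW : ∀ p, p ∈ W ↔ p = v ∨ p ∈ X₁)
    (E : IsSplitting f g h W Y₁ Y₂ ∨ IsSplitting g h f W Y₁ Y₂ ∨ IsSplitting h f g W Y₁ Y₂) :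
    False := by
  obtain ⟨⟨x₁, hx₁⟩, ⟨x₂, hx₂⟩, hmem, hh, hf, hg⟩ := D
  have mS : ∀ p, p ∈ X₁ ∨ p ∈ X₂ → p ∈ S ∧ p ≠ v := fun p hp => (hS' p).1 ((hmem p).2 hp)
  have cS : ∀ p ∈ S, p = v ∨ p ∈ X₁ ∨ p ∈ X₂ := by grind
  have ig := H.injg
  have ih := H.injh
  have nu := H.not_unanimous
  simp only [Set.InjOn, Finset.mem_coe] at ig ih
  obtain ⟨p, hp, hp1, hvp⟩ := hhf.exists_agreeAt (v := v) (· ∈ X₁) ⟨x₁, by grind⟩ hv (by grind)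
    (by intro p hp q hq h1 h2 h3; unfold AgreeAt; grind)
  unfold AgreeAt at hvp
  have hh2 : ∀ q ∈ X₂, h v < h q := by grind
  have hg2 : ∀ q ∈ X₂, g q < g v := by grind
  rcases E with E | E | E
  · obtain ⟨⟨y₁, hy₁⟩, ⟨y₂, hy₂⟩, hmY, ef, eg, eh⟩ := E
    have hvY : v ∈ Y₁ := by grind
    have dY : ∀ p ∈ Y₂, p ∉ Y₁ := by grind
    obtain ⟨z, hz, q', hq', hzY, hqY, hzq⟩ := hfg (· ∈ Y₂) ⟨y₂, by grind⟩ ⟨v, by grind⟩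
    have hqX : q' ∈ X₂ := by unfold AgreeAt at hzq; grind
    have hqz : f q' < f z ∧ g q' < g z := by unfold AgreeAt at hzq; grind
    have hzv : g z < g v := by grind
    -- `v`, `q'` and an element between `q'` and `v` for `g` must not form a forbidden triple.
    have nzv : ¬ h z < h v := by
      have := H.not_cyclic v hv q' hq' z hz
      grind
    have hvY2 : ∀ y ∈ Y₂, h v < h y := by grind
    have hY1 : ∀ y ∈ Y₁, y ≠ v → ¬ (g y < g v ∧ h y < h v) := by
      intro y hy hyv
      have := H.not_cyclic v hv q' hq' y (by grind)
      grind
    -- `v` is isolated in the graph of `g` and `h`.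
    obtain ⟨p, hp, q, hq, h1, h2, h3⟩ := hgh (· = v) ⟨v, hv, rfl⟩ ⟨x₁, by grind⟩
    rw [h1] at h3
    unfold AgreeAt at h3
    have nvq := nu v hv q hq
    have fvq := hmin q hq h2
    rcases cS q hq with e | e | e
    · exact h2 e
    · rcases (hmY q).1 ((hW q).2 (Or.inr e)) with e' | e'
      · have := hY1 q e' h2
        omega
      · have := hvY2 q e'
        have := eg v hvY q e'
        omega
    · have := hh2 q e
      have := hg2 q e
      omega
  · obtain ⟨⟨y₁, hy₁⟩, ⟨y₂, hy₂⟩, hmY, eg, eh, ef⟩ := E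
    have dY : ∀ p ∈ Y₂, p ∉ Y₁ := by grind
    have nY : ∀ p ∈ Y₁, ∀ q ∈ Y₂, ¬ AgreeAt g h p q := by unfold AgreeAt; grind
    have nv : ∀ q ∈ X₂, ¬ AgreeAt g h v q := by unfold AgreeAt; grind
    -- `X₂` must connect `Y₂` to the rest in the graph of `g` and `h`.
    have e2 : ∃ y ∈ Y₂, ∃ q ∈ X₂, y ≠ v ∧ g y < g q := by
      by_cases hvY : v ∈ Y₁
      · obtain ⟨z, hz, q', hq', hzY, hqY, hzq⟩ := hgh (· ∈ Y₂) ⟨y₂, by grind⟩ ⟨v, by grind⟩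
        unfold AgreeAt at *
        grind
      · obtain ⟨z, hz, q', hq', hzY, hqY, hzq⟩ :=
          hgh (fun x => x ∈ Y₁ ∨ x ∈ X₂) ⟨y₁, by grind⟩ ⟨v, by grind⟩
        unfold AgreeAt at *
        grind
    obtain ⟨y, hy, q, hq, hyv, hyq⟩ := e2
    have hY1 : ∀ p ∈ Y₁, ∀ q ∈ X₂, g p < g q := by
      intro p hp q' hq'
      have h1 := eg p hp y hy
      have h2 : y ∈ X₁ := by grind
      rcases hg y h2 with h3 | h3
      · exact h1.trans (h3 q' hq')
      · exact absurd (h3 q hq) (by omega)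
    have hvY : v ∈ Y₂ := by grind
    -- `Y₁` is closed in the graph of `f` and `g`.
    have ef' : ∀ p ∈ Y₁, ∀ q ∈ Y₂, f q < f p := by grind
    obtain ⟨z, hz, q', hq', hzY, hqY, hzq⟩ := hfg (· ∈ Y₁) ⟨y₁, by grind⟩ ⟨v, by grind⟩
    unfold AgreeAt at *
    grind
  · obtain ⟨⟨y₁, hy₁⟩, ⟨y₂, hy₂⟩, hmY, eh, ef, eg⟩ := E
    have dY : ∀ p ∈ Y₂, p ∉ Y₁ := by grind
    -- In the graph of `h` and `f`, `X₂` is attached to `v` only, so the part without `v` is closed.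
    by_cases hvY : v ∈ Y₁
    · obtain ⟨z, hz, q', hq', hzY, hqY, hzq⟩ := hhf (· ∈ Y₂) ⟨y₂, by grind⟩ ⟨v, by grind⟩
      unfold AgreeAt at *
      grind
    · obtain ⟨z, hz, q', hq', hzY, hqY, hzq⟩ := hhf (· ∈ Y₁) ⟨y₁, by grind⟩ ⟨v, by grind⟩
      unfold AgreeAt at *
      grind

/-- If the parts are separated for `g` and `h`, then splitting `X₁ ∪ {v}` as well leads to a
disconnected agreement graph on `S`. -/
lemma false_of_isSplitting_min_gh {W Y₁ Y₂ : Finset X} (H : IsTriOrder f g h S)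
    (hfg : AgreeConnected f g S) (hgh : AgreeConnected g h S)
    (hhf : AgreeConnected h f S) (hv : v ∈ S) (hmin : ∀ p ∈ S, p ≠ v → f v < f p)
    {S' : Finset X} (hS' : ∀ p, p ∈ S' ↔ p ∈ S ∧ p ≠ v)
    (D : IsSplitting g h f S' X₁ X₂) (hW : ∀ p, p ∈ W ↔ p = v ∨ p ∈ X₁)
    (E : IsSplitting f g h W Y₁ Y₂ ∨ IsSplitting g h f W Y₁ Y₂ ∨ IsSplitting h f g W Y₁ Y₂) :
    False := by
  obtain ⟨⟨x₁, hx₁⟩, ⟨x₂, hx₂⟩, hmem, hg, hh, hf⟩ := D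
  have mS : ∀ p, p ∈ X₁ ∨ p ∈ X₂ → p ∈ S ∧ p ≠ v := fun p hp => (hS' p).1 ((hmem p).2 hp)
  have cS : ∀ p ∈ S, p = v ∨ p ∈ X₁ ∨ p ∈ X₂ := by grind
  have ig := H.injg
  have ih := H.injh
  have nu := H.not_unanimous
  simp only [Set.InjOn, Finset.mem_coe] at ig ih
  obtain ⟨p, hp, hp1, hvp⟩ := hgh.exists_agreeAt (v := v) (· ∈ X₁) ⟨x₁, by grind⟩ hv (by grind)
    (by intro p hp q hq h1 h2 h3; unfold AgreeAt; grind)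
  obtain ⟨c, hc, hc2, hvc⟩ := hgh.exists_agreeAt (v := v) (· ∈ X₂) ⟨x₂, by grind⟩ hv (by grind)
    (by intro p hp q hq h1 h2 h3; unfold AgreeAt; grind)
  unfold AgreeAt at hvp hvc
  have hh2 : ∀ q ∈ X₂, h q < h v := by grind
  have hg1 : ∀ q ∈ X₁, g q < g v := by grind
  -- Otherwise `v`, `b`, `c` would form a forbidden triple.
  have hb : ∀ b ∈ X₁, f b < f x₂ → h b < h v := by
    intro b hb hbx
    have := H.not_cyclic v hv b (by grind) c hc
    grind
  rcases E with E | E | E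
  · obtain ⟨⟨y₁, hy₁⟩, ⟨y₂, hy₂⟩, hmY, ef, eg, eh⟩ := E
    have hvY : v ∈ Y₁ := by grind
    have dY : ∀ p ∈ Y₂, p ∉ Y₁ := by grind
    obtain ⟨z, hz, q', hq', hzY, hqY, hzq⟩ := hfg (· ∈ Y₂) ⟨y₂, by grind⟩ ⟨v, by grind⟩
    have hqX : q' ∈ X₂ := by unfold AgreeAt at hzq; grind
    have hqz : f z < f x₂ := by unfold AgreeAt at hzq; grind
    have hY1 : ∀ y ∈ Y₁, y ≠ v → f y < f x₂ := by grind
    have hvY2 : ∀ y ∈ Y₂, h y < h v := by grind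
    -- `v` is isolated in the graph of `h` and `f`.
    obtain ⟨p, hp, q, hq, h1, h2, h3⟩ := hhf (· = v) ⟨v, hv, rfl⟩ ⟨x₁, by grind⟩
    rw [h1] at h3
    unfold AgreeAt at h3
    have nvq := nu v hv q hq
    have fvq := hmin q hq h2
    rcases cS q hq with e | e | e
    · exact h2 e
    · rcases (hmY q).1 ((hW q).2 (Or.inr e)) with e' | e'
      · have := hb q e (hY1 q e' h2)
        omega
      · have := hvY2 q e'
        omega
    · have := hh2 q e
      omega
  · obtain ⟨⟨y₁, hy₁⟩, ⟨y₂, hy₂⟩, hmY, eg, eh, ef⟩ := E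
    have dY : ∀ p ∈ Y₂, p ∉ Y₁ := by grind
    -- In the graph of `g` and `h`, `X₂` is attached to `v` only, so the part without `v` is closed.
    by_cases hvY : v ∈ Y₁
    · obtain ⟨z, hz, q', hq', hzY, hqY, hzq⟩ := hgh (· ∈ Y₂) ⟨y₂, by grind⟩ ⟨v, by grind⟩
      unfold AgreeAt at *
      grind
    · obtain ⟨z, hz, q', hq', hzY, hqY, hzq⟩ := hgh (· ∈ Y₁) ⟨y₁, by grind⟩ ⟨v, by grind⟩
      unfold AgreeAt at *
      grind
  · obtain ⟨⟨y₁, hy₁⟩, ⟨y₂, hy₂⟩, hmY, eh, ef, eg⟩ := E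
    have hvY : v ∈ Y₂ := by grind
    have dY : ∀ p ∈ Y₂, p ∉ Y₁ := by grind
    have nY : ∀ p ∈ Y₁, ∀ q ∈ Y₂, ¬ AgreeAt h f p q := by unfold AgreeAt; grind
    have nv : ∀ q ∈ X₂, ¬ AgreeAt h f v q := by unfold AgreeAt; grind
    -- `X₂` must connect `Y₁` to the rest in the graph of `h` and `f`.
    have e2 : ∃ y ∈ Y₂, y ≠ v ∧ f x₂ < f y := by
      obtain ⟨z, hz, q', hq', hzY, hqY, hzq⟩ :=
        hhf (fun x => x ∈ Y₁ ∨ x ∈ X₂) ⟨y₁, by grind⟩ ⟨v, by grind⟩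
      have hq2 : q' ∈ Y₂ := by grind
      rcases hzY with hzY | hzX
      · exact absurd hzq (nY z hzY q' hq2)
      · have hqv : q' ≠ v := fun e => nv z hzX (e ▸ hzq.symm)
        have hq1 : q' ∈ X₁ := by grind
        refine ⟨q', hq2, hqv, ?_⟩
        have := hh q' hq1 z hzX
        unfold AgreeAt at hzq
        rcases hf q' hq1 with h3 | h3
        · have := h3 z hzX
          omega
        · exact h3 x₂ hx₂
    obtain ⟨y, hy, hyv, hyx⟩ := e2
    have hY1 : ∀ p ∈ Y₁, ∀ q ∈ X₂, f q < f p := by grind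
    -- `Y₁` is closed in the graph of `f` and `g`.
    have eg' : ∀ p ∈ Y₁, ∀ q ∈ Y₂, g p < g q := by grind
    obtain ⟨z, hz, q', hq', hzY, hqY, hzq⟩ := hfg (· ∈ Y₁) ⟨y₁, by grind⟩ ⟨v, by grind⟩
    unfold AgreeAt at *
    grind

end Extension

/-- Three orders without unanimous pairs and without `abc`, `bca`, `cab` triples on at least two
elements always split: one of the three agreement graphs is disconnected. -/
theorem IsTriOrder.exists_isSplitting {X : Type*} {f g h : X → ℕ} {S : Finset X}
    (H : IsTriOrder f g h S) (hS : 2 ≤ S.card) :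
    ∃ S₁ S₂, IsSplitting f g h S S₁ S₂ ∨ IsSplitting g h f S S₁ S₂ ∨ IsSplitting h f g S S₁ S₂ := by
  classical
  induction hn : S.card using Nat.strong_induction_on generalizing S with
  | _ n IH =>
  subst hn
  by_contra hcon
  push Not at hcon
  have hfg : AgreeConnected f g S := by
    by_contra h0
    obtain ⟨S₁, S₂, h1⟩ := exists_isSplitting_of_not_agreeConnected H h0
    exact (hcon S₁ S₂).1 h1
  have hgh : AgreeConnected g h S := by
    by_contra h0
    obtain ⟨S₁, S₂, h1⟩ := exists_isSplitting_of_not_agreeConnected H.rotate h0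
    exact (hcon S₁ S₂).2.1 h1
  have hhf : AgreeConnected h f S := by
    by_contra h0
    obtain ⟨S₁, S₂, h1⟩ := exists_isSplitting_of_not_agreeConnected H.rotate.rotate h0
    exact (hcon S₁ S₂).2.2 h1
  obtain ⟨v, hv, hmin⟩ := S.exists_min_image f (Finset.card_pos.1 (by omega))
  have hmin' : ∀ p ∈ S, p ≠ v → f v < f p := fun p hp hpv =>
    lt_of_le_of_ne (hmin p hp) fun e => hpv (H.injf hp hv e.symm)
  have hmem : ∀ p, p ∈ S.erase v ↔ p ∈ S ∧ p ≠ v := fun p => by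
    rw [Finset.mem_erase, and_comm]
  have hcard : (S.erase v).card = S.card - 1 := Finset.card_erase_of_mem hv
  -- On two elements, connectedness of two of the graphs gives a unanimous pair.
  rcases Nat.lt_or_ge (S.erase v).card 2 with h2 | h2
  · obtain ⟨w, hw⟩ := Finset.card_eq_one.1 (show (S.erase v).card = 1 by omega)
    have hwS : w ∈ S ∧ w ≠ v := (hmem w).1 (by simp [hw])
    have only : ∀ q ∈ S, ¬ q = v → q = w := fun q hq hqv => by
      have := (hmem q).2 ⟨hq, hqv⟩
      simpa [hw] using this
    obtain ⟨p, hp, q, hq, hpv, hqv, h3⟩ := hfg (· = v) ⟨v, hv, rfl⟩ ⟨w, hwS.1, hwS.2⟩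
    obtain ⟨p', hp', q', hq', hpv', hqv', h3'⟩ := hgh (· = v) ⟨v, hv, rfl⟩ ⟨w, hwS.1, hwS.2⟩
    have e1 := H.not_unanimous p hp q hq
    have e2 := H.not_unanimous q hq p hp
    rw [hpv', only q' hq' hqv', ← only q hq hqv, ← hpv] at h3'
    unfold AgreeAt at h3 h3'
    omega
  · obtain ⟨X₁, X₂, hX⟩ := IH _ (by omega) (H.mono (Finset.erase_subset _ _)) h2 rfl
    have hW : ∀ p, p ∈ insert v X₁ ↔ p = v ∨ p ∈ X₁ := fun p => Finset.mem_insert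
    have split : ∀ f' g' h' : X → ℕ, IsSplitting f' g' h' (S.erase v) X₁ X₂ →
        ∃ Y₁ Y₂, IsSplitting f g h (insert v X₁) Y₁ Y₂ ∨ IsSplitting g h f (insert v X₁) Y₁ Y₂ ∨
          IsSplitting h f g (insert v X₁) Y₁ Y₂ := by
      intro f' g' h' D
      have sub : insert v X₁ ⊆ S := by
        intro p hp
        rcases (hW p).1 hp with e | e
        · exact e ▸ hv
        · exact ((hmem p).1 ((D.mem_iff p).2 (Or.inl e))).1
      obtain ⟨b, hb⟩ := D.nonempty₂
      obtain ⟨a, ha⟩ := D.nonempty₁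
      have hbS := (hmem b).1 ((D.mem_iff b).2 (Or.inr hb))
      have haS := (hmem a).1 ((D.mem_iff a).2 (Or.inl ha))
      have hbW : b ∉ insert v X₁ := fun hbW => by
        rcases (hW b).1 hbW with e | e
        · exact hbS.2 e
        · exact lt_irrefl _ (D.lt_f b e b hb)
      refine IH _ (Finset.card_lt_card ⟨sub, fun hs => hbW (hs hbS.1)⟩) (H.mono sub) ?_ rfl
      exact Finset.one_lt_card.2 ⟨v, (hW v).2 (Or.inl rfl), a, (hW a).2 (Or.inr ha), haS.2.symm⟩
    rcases hX with hX | hX | hX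
    · exact false_of_isSplitting_min_fg H hfg hgh hhf hv hmin' hmem hX
    · obtain ⟨Y₁, Y₂, hY⟩ := split _ _ _ hX
      exact false_of_isSplitting_min_gh H hfg hgh hhf hv hmin' hmem hX hW hY
    · obtain ⟨Y₁, Y₂, hY⟩ := split _ _ _ hX
      exact false_of_isSplitting_min_hf H hfg hgh hhf hv hmin' hmem hX hW hY

/-- A splitting combines three-order structures on its parts to one on the whole. -/
lemma IsSplitting.isTriOrder {X : Type*} {f g h : X → ℕ} {S S₁ S₂ : Finset X}
    (D : IsSplitting f g h S S₁ S₂) (H₁ : IsTriOrder f g h S₁) (H₂ : IsTriOrder f g h S₂) :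
    IsTriOrder f g h S := by
  obtain ⟨-, -, hm, hf, hg, hh⟩ := D
  refine ⟨?_, ?_, ?_, ?_, ?_⟩
  · intro p hp q hq e
    rcases (hm p).1 hp with hp | hp <;> rcases (hm q).1 hq with hq | hq
    · exact H₁.injf hp hq e
    · have := hf p hp q hq
      omega
    · have := hf q hq p hp
      omega
    · exact H₂.injf hp hq e
  · intro p hp q hq e
    rcases (hm p).1 hp with hp | hp <;> rcases (hm q).1 hq with hq | hq
    · exact H₁.injg hp hq e
    · have := hg p hp q hq
      omega
    · have := hg q hq p hp
      omega
    · exact H₂.injg hp hq e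
  · intro p hp q hq e
    rcases (hm p).1 hp with hp | hp <;> rcases (hm q).1 hq with hq | hq
    · exact H₁.injh hp hq e
    · rcases hh p hp with h1 | h1 <;> have := h1 q hq <;> omega
    · rcases hh q hq with h1 | h1 <;> have := h1 p hp <;> omega
    · exact H₂.injh hp hq e
  · rintro p hp q hq ⟨h1, h2, h3⟩
    rcases (hm p).1 hp with hp | hp <;> rcases (hm q).1 hq with hq | hq
    · exact H₁.not_unanimous p hp q hq ⟨h1, h2, h3⟩
    · have := hg p hp q hq
      omega
    · have := hf q hq p hp
      omega
    · exact H₂.not_unanimous p hp q hq ⟨h1, h2, h3⟩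
  · rintro a ha b hb c hc ⟨⟨h1, h2⟩, ⟨h3, h4⟩, h5, h6⟩
    rcases (hm a).1 ha with ha | ha <;> rcases (hm b).1 hb with hb | hb <;>
      rcases (hm c).1 hc with hc | hc
    · exact H₁.not_cyclic a ha b hb c hc ⟨⟨h1, h2⟩, ⟨h3, h4⟩, h5, h6⟩
    · have := hg b hb c hc
      omega
    · have := hf c hc b hb
      omega
    · rcases hh a ha with e | e
      · have := e c hc
        omega
      · have := e b hb
        omega
    · have := hf b hb a ha
      omega
    · have := hf b hb a ha
      omega
    · have := hf c hc b hb
      omega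
    · exact H₂.not_cyclic a ha b hb c hc ⟨⟨h1, h2⟩, ⟨h3, h4⟩, h5, h6⟩

/-! ### Counting inversions between two orders -/

/-- The number of elements of `S` that lie above `p` for `a` and below `p` for `b`. -/
def invCount {X : Type*} (a b : X → ℕ) (S : Finset X) (p : X) : ℕ :=
  (S.filter fun j => a p < a j ∧ b j < b p).card

section Count

variable {X : Type*} {a b : X → ℕ} {S S₁ S₂ : Finset X}

lemma invCount_union [DecidableEq X] (hd : Disjoint S₁ S₂) (p : X) :
    invCount a b (S₁ ∪ S₂) p = invCount a b S₁ p + invCount a b S₂ p := by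
  unfold invCount
  rw [Finset.filter_union, Finset.card_union_of_disjoint (Finset.disjoint_filter_filter hd)]

lemma invCount_eq_zero {p : X} (h : ∀ j ∈ S, ¬ (a p < a j ∧ b j < b p)) :
    invCount a b S p = 0 := by
  unfold invCount
  rw [Finset.card_eq_zero, Finset.filter_eq_empty_iff]
  exact h
end Count

/-! ### Triangles and point sets that build them by merging -/

/-- The three barycentric coordinates of a cell, with sum `0`; the window cell with index `i` is
the one whose coordinate `i` is raised. -/
def bary (i : Fin 3) (p : ℤ × ℤ) : ℤ := ![-p.1 - p.2, p.1, p.2] i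

@[simp] lemma bary_zero (p : ℤ × ℤ) : bary 0 p = -p.1 - p.2 := rfl
@[simp] lemma bary_one (p : ℤ × ℤ) : bary 1 p = p.1 := rfl
@[simp] lemma bary_two (p : ℤ × ℤ) : bary 2 p = p.2 := rfl

/-- The translated triangle of the cells with barycentric coordinates at least `u`; its side
consists of `1 - (u 0 + u 1 + u 2)` cells. -/
def baryTriangle (u : Fin 3 → ℤ) : Set (ℤ × ℤ) := {p | ∀ i, u i ≤ bary i p}

lemma triangle_eq_baryTriangle (n : ℕ) : triangle n = baryTriangle ![1 - (n : ℤ), 0, 0] := by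
  ext p
  simp only [triangle, baryTriangle, Set.mem_ofPred_eq, Fin.forall_fin_succ, Fin.isValue]
  simp [bary]
  omega

/-- `u` bounds the smallest triangle containing the disjoint but touching triangles bounded by `v`
and `w`: the first one sits in the corner of maximal coordinate `i`, the second one on the side
opposite to it. -/
structure IsMerge (i : Fin 3) (u v w : Fin 3 → ℤ) : Prop where
  eq₀ : w i = u i
  eq₁ : v (i + 1) = u (i + 1)
  eq₂ : v (i + 2) = u (i + 2)
  le₀ : u i ≤ v i
  le₁ : u (i + 1) ≤ w (i + 1)
  le₂ : u (i + 2) ≤ w (i + 2)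
  sum_eq : v i + w (i + 1) + w (i + 2) = 1

/-- `P` builds the triangle bounded by `u` if this triangle arises from the single cells of `P` by
repeatedly merging two disjoint touching triangles. -/
inductive Builds : Finset (ℤ × ℤ) → (Fin 3 → ℤ) → Prop
  | single (p : ℤ × ℤ) : Builds {p} fun i => bary i p
  | merge (i : Fin 3) {P Q : Finset (ℤ × ℤ)} {u v w : Fin 3 → ℤ} (hP : Builds P v)
      (hQ : Builds Q w) (h : IsMerge i u v w) : Builds (P ∪ Q) u

lemma sum_rotate (u : Fin 3 → ℤ) (i : Fin 3) : u i + u (i + 1) + u (i + 2) = u 0 + u 1 + u 2 := by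
  fin_cases i <;> simp <;> ring_nf

lemma forall_fin_three_iff (i : Fin 3) (p : Fin 3 → Prop) :
    (∀ j, p j) ↔ p i ∧ p (i + 1) ∧ p (i + 2) := by
  constructor
  · exact fun h => ⟨h _, h _, h _⟩
  · rintro ⟨h0, h1, h2⟩ j
    have : j = i ∨ j = i + 1 ∨ j = i + 2 := by omega
    rcases this with rfl | rfl | rfl <;> assumption

lemma bary_sum (p : ℤ × ℤ) (i : Fin 3) : bary i p + bary (i + 1) p + bary (i + 2) p = 0 := by
  rw [sum_rotate (fun j => bary j p)]
  simp only [bary_zero, bary_one, bary_two]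
  ring

lemma mem_baryTriangle_iff (i : Fin 3) {u : Fin 3 → ℤ} {p : ℤ × ℤ} : p ∈ baryTriangle u ↔
    u i ≤ bary i p ∧ u (i + 1) ≤ bary (i + 1) p ∧ u (i + 2) ≤ bary (i + 2) p :=
  forall_fin_three_iff i _

lemma IsMerge.subset_left {i : Fin 3} {u v w : Fin 3 → ℤ} (h : IsMerge i u v w) :
    baryTriangle v ⊆ baryTriangle u := by
  intro p hp
  rw [mem_baryTriangle_iff i] at *
  obtain ⟨_, _, _, _, _, _, _⟩ := h
  omega

lemma IsMerge.subset_right {i : Fin 3} {u v w : Fin 3 → ℤ} (h : IsMerge i u v w) :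
    baryTriangle w ⊆ baryTriangle u := by
  intro p hp
  rw [mem_baryTriangle_iff i] at *
  obtain ⟨_, _, _, _, _, _, _⟩ := h
  omega

lemma IsMerge.disjoint {i : Fin 3} {u v w : Fin 3 → ℤ} (h : IsMerge i u v w) :
    Disjoint (baryTriangle v) (baryTriangle w) := by
  rw [Set.disjoint_left]
  intro p hp hq
  rw [mem_baryTriangle_iff i] at *
  have := bary_sum p i
  obtain ⟨_, _, _, _, _, _, _⟩ := h
  omega

lemma Builds.subset {P : Finset (ℤ × ℤ)} {u : Fin 3 → ℤ} (h : Builds P u) :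
    (P : Set (ℤ × ℤ)) ⊆ baryTriangle u := by
  induction h with
  | single p =>
    intro q hq i
    simp only [Finset.coe_singleton, Set.mem_singleton_iff] at hq
    rw [hq]
  | merge i hP hQ h ihP ihQ =>
    rw [Finset.coe_union]
    exact Set.union_subset (ihP.trans h.subset_left) (ihQ.trans h.subset_right)

lemma Builds.nonempty {P : Finset (ℤ × ℤ)} {u : Fin 3 → ℤ} (h : Builds P u) : P.Nonempty := by
  induction h with
  | single p => exact Finset.singleton_nonempty p
  | merge i hP hQ h ihP ihQ => exact ihP.mono Finset.subset_union_left

lemma IsMerge.disjoint_finset {i : Fin 3} {u v w : Fin 3 → ℤ} (h : IsMerge i u v w)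
    {P Q : Finset (ℤ × ℤ)} (hP : Builds P v) (hQ : Builds Q w) : Disjoint P Q :=
  Finset.disjoint_coe.1 (h.disjoint.mono hP.subset hQ.subset)

lemma Builds.card {P : Finset (ℤ × ℤ)} {u : Fin 3 → ℤ} (h : Builds P u) :
    (P.card : ℤ) = 1 - (u 0 + u 1 + u 2) := by
  induction h with
  | single p =>
    simp only [bary_zero, bary_one, bary_two, Finset.card_singleton]
    push_cast
    ring
  | merge i hP hQ h ihP ihQ =>
    rw [Finset.card_union_of_disjoint (h.disjoint_finset hP hQ)]
    push_cast
    rw [ihP, ihQ, ← sum_rotate _ i, ← sum_rotate _ i, ← sum_rotate _ i]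
    obtain ⟨_, _, _, _, _, _, _⟩ := h
    omega

/-! ### Three orders build a triangle -/

section Splitting

variable {X : Type*} {f g h : X → ℕ} {S S₁ S₂ : Finset X}

lemma IsSplitting.disjoint (D : IsSplitting f g h S S₁ S₂) : Disjoint S₁ S₂ :=
  Finset.disjoint_left.2 fun p h1 h2 => lt_irrefl _ (D.lt_f p h1 p h2)

lemma IsSplitting.eq_union [DecidableEq X] (D : IsSplitting f g h S S₁ S₂) : S = S₁ ∪ S₂ := by
  ext p
  rw [D.mem_iff, Finset.mem_union]

lemma IsSplitting.invCount_fg_left (D : IsSplitting f g h S S₁ S₂) {p : X} (hp : p ∈ S₁) :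
    invCount f g S p = invCount f g S₁ p + S₂.card := by
  classical
  rw [D.eq_union, invCount_union D.disjoint]
  congr 1
  unfold invCount
  rw [Finset.filter_true_of_mem]
  exact fun q hq => ⟨D.lt_f p hp q hq, D.lt_g p hp q hq⟩

lemma IsSplitting.invCount_hf_left (D : IsSplitting f g h S S₁ S₂) {p : X} (hp : p ∈ S₁) :
    invCount h f S p = invCount h f S₁ p := by
  classical
  rw [D.eq_union, invCount_union D.disjoint, invCount_eq_zero (S := S₂), add_zero]
  exact fun q hq e => absurd e.2 (D.lt_f p hp q hq).not_gt

lemma IsSplitting.invCount_gh_left (D : IsSplitting f g h S S₁ S₂) {p : X} (hp : p ∈ S₁) :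
    invCount g h S p = invCount g h S₁ p := by
  classical
  rw [D.eq_union, invCount_union D.disjoint, invCount_eq_zero (S := S₂), add_zero]
  exact fun q hq e => absurd e.1 (D.lt_g p hp q hq).not_gt

lemma IsSplitting.invCount_fg_right (D : IsSplitting f g h S S₁ S₂) {q : X} (hq : q ∈ S₂) :
    invCount f g S q = invCount f g S₂ q := by
  classical
  rw [D.eq_union, invCount_union D.disjoint, invCount_eq_zero (S := S₁), zero_add]
  exact fun p hp e => absurd e.1 (D.lt_f p hp q hq).not_gt

lemma IsSplitting.invCount_hf_right (D : IsSplitting f g h S S₁ S₂) {q : X} (hq : q ∈ S₂) :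
    invCount h f S q = invCount h f S₂ q + (S₁.filter fun p => h q < h p).card := by
  classical
  rw [D.eq_union, invCount_union D.disjoint, add_comm]
  congr 1
  unfold invCount
  congr 1
  ext p
  simp only [Finset.mem_filter]
  exact ⟨fun e => ⟨e.1, e.2.1⟩, fun e => ⟨e.1, e.2, D.lt_f p e.1 q hq⟩⟩

lemma IsSplitting.invCount_gh_right (D : IsSplitting f g h S S₁ S₂) {q : X} (hq : q ∈ S₂) :
    invCount g h S q = invCount g h S₂ q + (S₁.filter fun p => h p < h q).card := by
  classical
  rw [D.eq_union, invCount_union D.disjoint, add_comm]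
  congr 1
  unfold invCount
  congr 1
  ext p
  simp only [Finset.mem_filter]
  exact ⟨fun e => ⟨e.1, e.2.2⟩, fun e => ⟨e.1, D.lt_g p e.1 q hq, e.2⟩⟩

end Splitting

/-- A family of three orders indexed so that the `i`-th coordinate of an element counts its
inversions between the orders `i` and `i + 2`. -/
def IsTriFamily {X : Type*} (o : Fin 3 → X → ℕ) (S : Finset X) : Prop :=
  IsTriOrder (o 1) (o 0) (o 2) S

lemma isTriFamily_iff {X : Type*} {o : Fin 3 → X → ℕ} {S : Finset X} (i : Fin 3) :
    IsTriFamily o S ↔ IsTriOrder (o i) (o (i + 2)) (o (i + 1)) S := by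
  unfold IsTriFamily
  fin_cases i
  · exact ⟨fun H => H.rotate, fun H => H.rotate.rotate⟩
  · exact Iff.rfl
  · exact ⟨fun H => H.rotate.rotate, fun H => H.rotate⟩

/-- The `i`-th inversion count of a family of three orders. -/
def triCount {X : Type*} (o : Fin 3 → X → ℕ) (S : Finset X) (i : Fin 3) (p : X) : ℕ :=
  invCount (o i) (o (i + 2)) S p

/-- The cell `r` carries the inversion counts of `p`, as coordinates relative to the triangle
bounded by `u`. -/
def IsPlaced {X : Type*} (o : Fin 3 → X → ℕ) (S : Finset X) (u : Fin 3 → ℤ) (p : X) (r : ℤ × ℤ) :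
    Prop :=
  ∀ i, bary i r = triCount o S i p + u i

section Placement

variable {X : Type*} {o : Fin 3 → X → ℕ} {S S₁ S₂ : Finset X} {i : Fin 3} {u v w : Fin 3 → ℤ}

lemma isPlaced_left_iff (D : IsSplitting (o i) (o (i + 2)) (o (i + 1)) S S₁ S₂)
    (h0 : v i = u i + S₂.card) (h1 : v (i + 1) = u (i + 1)) (h2 : v (i + 2) = u (i + 2)) {p : X}
    (hp : p ∈ S₁) {r : ℤ × ℤ} : IsPlaced o S u p r ↔ IsPlaced o S₁ v p r := by
  have e1 : i + 1 + 2 = i := by omega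
  have e2 : i + 2 + 2 = i + 1 := by omega
  unfold IsPlaced triCount
  rw [forall_fin_three_iff i, forall_fin_three_iff i, h0, h1, h2, e1, e2, D.invCount_fg_left hp,
    D.invCount_hf_left hp, D.invCount_gh_left hp]
  push_cast
  constructor <;> rintro ⟨_, _, _⟩ <;> refine ⟨?_, ?_, ?_⟩ <;> omega

lemma isPlaced_right_iff (D : IsSplitting (o i) (o (i + 2)) (o (i + 1)) S S₁ S₂) {q : X}
    (hq : q ∈ S₂) (h0 : w i = u i)
    (h1 : w (i + 1) = u (i + 1) + (S₁.filter fun p => o (i + 1) q < o (i + 1) p).card)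
    (h2 : w (i + 2) = u (i + 2) + (S₁.filter fun p => o (i + 1) p < o (i + 1) q).card)
    {r : ℤ × ℤ} : IsPlaced o S u q r ↔ IsPlaced o S₂ w q r := by
  have e1 : i + 1 + 2 = i := by omega
  have e2 : i + 2 + 2 = i + 1 := by omega
  unfold IsPlaced triCount
  rw [forall_fin_three_iff i, forall_fin_three_iff i, h0, h1, h2, e1, e2, D.invCount_fg_right hq,
    D.invCount_hf_right hq, D.invCount_gh_right hq]
  push_cast
  constructor <;> rintro ⟨_, _, _⟩ <;> refine ⟨?_, ?_, ?_⟩ <;> omega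

/-- The elements of `S₁` lie either above or below `S₂` for the third order. -/
lemma IsSplitting.card_filter_add {f g h : X → ℕ} (D : IsSplitting f g h S S₁ S₂) {q : X}
    (hq : q ∈ S₂) :
    (S₁.filter fun p => h q < h p).card + (S₁.filter fun p => h p < h q).card = S₁.card := by
  rw [← Finset.card_filter_add_card_filter_not (s := S₁) (fun p => h q < h p)]
  congr 2
  apply Finset.filter_congr
  intro p hp
  rcases D.module_h p hp with e | e <;> have := e q hq <;> omega

/-- A family of three orders without unanimous pairs and cyclic triples places its elements on a
point set that builds the triangle of the right size. -/
theorem IsTriFamily.builds (H : IsTriFamily o S) (hS : S.Nonempty)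
    (hu : u 0 + u 1 + u 2 = 1 - S.card) (c : X → ℤ × ℤ) (hc : ∀ p ∈ S, IsPlaced o S u p (c p)) :
    Builds (S.image c) u := by
  classical
  induction hn : S.card using Nat.strong_induction_on generalizing S u with
  | _ n IH =>
  subst hn
  rcases Nat.lt_or_ge S.card 2 with h2 | h2
  · have h1 : S.card = 1 := by
      have := Finset.card_pos.2 hS
      omega
    obtain ⟨x, rfl⟩ := Finset.card_eq_one.1 h1
    have hx := hc x (Finset.mem_singleton_self x)
    have : u = fun i => bary i (c x) := by
      funext i
      rw [hx i]
      unfold triCount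
      rw [invCount_eq_zero]
      · simp
      · intro j hj
        rw [Finset.mem_singleton.1 hj]
        omega
    rw [this, Finset.image_singleton]
    exact Builds.single _
  · have main : ∃ (i : Fin 3) (S₁ S₂ : Finset X),
        IsSplitting (o i) (o (i + 2)) (o (i + 1)) S S₁ S₂ := by
      obtain ⟨S₁, S₂, h | h | h⟩ := IsTriOrder.exists_isSplitting H h2
      · exact ⟨1, S₁, S₂, h⟩
      · exact ⟨0, S₁, S₂, h⟩
      · exact ⟨2, S₁, S₂, h⟩
    obtain ⟨i, S₁, S₂, D⟩ := main
    obtain ⟨q₀, hq₀⟩ := D.nonempty₂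
    have ne1 : i + 1 ≠ i := by omega
    have ne2 : i + 2 ≠ i := by omega
    set α := (S₁.filter fun p => o (i + 1) q₀ < o (i + 1) p).card with hα
    set β := (S₁.filter fun p => o (i + 1) p < o (i + 1) q₀).card with hβ
    -- All elements of `S₂` are placed at the same height in the third order relative to `S₁`.
    have hαβ : ∀ q ∈ S₂, (S₁.filter fun p => o (i + 1) q < o (i + 1) p).card = α ∧
        (S₁.filter fun p => o (i + 1) p < o (i + 1) q).card = β := by
      intro q hq
      constructor <;>
      · refine congrArg Finset.card (Finset.filter_congr fun p hp => ?_)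
        rcases D.module_h p hp with e | e <;> have := e q hq <;> have := e q₀ hq₀ <;> omega
    have hsum : α + β = S₁.card := D.card_filter_add hq₀
    have hcard : S.card = S₁.card + S₂.card := by
      rw [D.eq_union, Finset.card_union_of_disjoint D.disjoint]
    have p1 := Finset.card_pos.2 D.nonempty₁
    have p2 := Finset.card_pos.2 D.nonempty₂
    -- Compared with the counts inside the parts, elements of `S₁` gain `S₂.card` inversions in
    -- direction `i`, and elements of `S₂` gain `α` and `β` in the other two directions.
    let v : Fin 3 → ℤ := fun j => if j = i then u j + S₂.card else u j
    let w : Fin 3 → ℤ := fun j => if j = i then u j else if j = i + 1 then u j + α else u j + β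
    have v0 : v i = u i + S₂.card := if_pos rfl
    have v1 : v (i + 1) = u (i + 1) := if_neg ne1
    have v2 : v (i + 2) = u (i + 2) := if_neg ne2
    have w0 : w i = u i := if_pos rfl
    have w1 : w (i + 1) = u (i + 1) + α := by simp [w]
    have w2 : w (i + 2) = u (i + 2) + β := by simp [w]
    have su := sum_rotate u i
    have sv := sum_rotate v i
    have sw := sum_rotate w i
    have B1 : Builds (S₁.image c) v := by
      refine IH _ (by omega) ?_ D.nonempty₁ (by omega) ?_ rfl
      · exact H.mono fun p hp => (D.mem_iff p).2 (Or.inl hp)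
      · exact fun p hp => (isPlaced_left_iff D v0 v1 v2 hp).1 (hc p ((D.mem_iff p).2 (Or.inl hp)))
    have B2 : Builds (S₂.image c) w := by
      refine IH _ (by omega) ?_ D.nonempty₂ (by omega) ?_ rfl
      · exact H.mono fun p hp => (D.mem_iff p).2 (Or.inr hp)
      · exact fun p hp => (isPlaced_right_iff D hp w0 (by rw [(hαβ p hp).1, w1])
          (by rw [(hαβ p hp).2, w2])).1 (hc p ((D.mem_iff p).2 (Or.inr hp)))
    rw [D.eq_union, Finset.image_union]
    exact Builds.merge i B1 B2 ⟨w0, v1, v2, by omega, by omega, by omega, by omega⟩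

end Placement

/-! ### Reading the three orders off a building set -/

section Reading

variable {i : Fin 3} {u v w : Fin 3 → ℤ} {P Q : Finset (ℤ × ℤ)} {o o' : Fin 3 → ℤ × ℤ → ℕ}

/-- Restricting to a subset on which the orders are unchanged does not change inversion counts. -/
lemma invCount_congr {X : Type*} {a b a' b' : X → ℕ} {S : Finset X} {p : X}
    (ha : ∀ j ∈ S, (a p < a j ↔ a' p < a' j)) (hb : ∀ j ∈ S, (b j < b p ↔ b' j < b' p)) :
    invCount a b S p = invCount a' b' S p := by
  unfold invCount
  congr 1
  exact Finset.filter_congr fun j hj => by rw [ha j hj, hb j hj]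

lemma IsTriOrder.congr {X : Type*} {f g h f' g' h' : X → ℕ} {S : Finset X}
    (H : IsTriOrder f g h S) (hf : ∀ p ∈ S, ∀ q ∈ S, (f p < f q ↔ f' p < f' q))
    (hg : ∀ p ∈ S, ∀ q ∈ S, (g p < g q ↔ g' p < g' q))
    (hh : ∀ p ∈ S, ∀ q ∈ S, (h p < h q ↔ h' p < h' q)) : IsTriOrder f' g' h' S where
  injf p hp q hq e := H.injf hp hq (by have := hf p hp q hq; have := hf q hq p hp; omega)
  injg p hp q hq e := H.injg hp hq (by have := hg p hp q hq; have := hg q hq p hp; omega)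
  injh p hp q hq e := H.injh hp hq (by have := hh p hp q hq; have := hh q hq p hp; omega)
  not_unanimous p hp q hq := by
    rw [← hf p hp q hq, ← hg p hp q hq, ← hh p hp q hq]
    exact H.not_unanimous p hp q hq
  not_cyclic a ha b hb c hc := by
    rw [← hf a ha b hb, ← hf b hb c hc, ← hg b hb c hc, ← hg c hc a ha, ← hh c hc a ha,
      ← hh a ha b hb]
    exact H.not_cyclic a ha b hb c hc

/-- Ranking functions on `P` that place every cell of `P` on itself. -/
structure IsReading (o : Fin 3 → ℤ × ℤ → ℕ) (P : Finset (ℤ × ℤ)) (u : Fin 3 → ℤ) : Prop where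
  family : IsTriFamily o P
  rank_lt : ∀ i, ∀ p ∈ P, o i p < P.card
  placed : ∀ p ∈ P, IsPlaced o P u p p

/-- Merging two triangles: the elements of the second part are inserted as a block into the third
order of the first part. -/
lemma IsMerge.exists_isReading (hm : IsMerge i u v w) (hP : Builds P v) (hQ : Builds Q w)
    (ho : IsReading o P v) (ho' : IsReading o' Q w) : ∃ o'', IsReading o'' (P ∪ Q) u := by
  have hd := hm.disjoint_finset hP hQ
  have hcard : (P ∪ Q).card = P.card + Q.card := Finset.card_union_of_disjoint hd
  have cP := hP.card
  have cQ := hQ.card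
  rw [← sum_rotate v i] at cP
  rw [← sum_rotate w i] at cQ
  have hm' := hm
  obtain ⟨e0, e1, e2, l0, l1, l2, hs⟩ := hm'
  -- In the third order, exactly `β` elements of `P` lie below `Q`.
  obtain ⟨β, hβ⟩ : ∃ β : ℕ, (β : ℤ) = w (i + 2) - u (i + 2) :=
    ⟨(w (i + 2) - u (i + 2)).toNat, by omega⟩
  let f : ℤ × ℤ → ℕ := fun p => if p ∈ P then o i p else P.card + o' i p
  let g : ℤ × ℤ → ℕ := fun p => if p ∈ P then Q.card + o (i + 2) p else o' (i + 2) p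
  let h : ℤ × ℤ → ℕ := fun p => if p ∈ P then
    (if o (i + 1) p < β then o (i + 1) p else Q.card + o (i + 1) p) else β + o' (i + 1) p
  have fP : ∀ p ∈ P, f p = o i p := fun p hp => if_pos hp
  have gP : ∀ p ∈ P, g p = Q.card + o (i + 2) p := fun p hp => if_pos hp
  have hP' : ∀ p ∈ P, h p = if o (i + 1) p < β then o (i + 1) p else Q.card + o (i + 1) p :=
    fun p hp => if_pos hp
  have nQ : ∀ q ∈ Q, q ∉ P := fun q hq hp => Finset.disjoint_left.1 hd hp hq
  have fQ : ∀ p ∈ Q, f p = P.card + o' i p := fun p hp => if_neg (nQ p hp)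
  have gQ : ∀ p ∈ Q, g p = o' (i + 2) p := fun p hp => if_neg (nQ p hp)
  have hQ' : ∀ p ∈ Q, h p = β + o' (i + 1) p := fun p hp => if_neg (nQ p hp)
  have rf := ho.rank_lt i
  have rg := ho.rank_lt (i + 2)
  have rh := ho.rank_lt (i + 1)
  have rf' := ho'.rank_lt i
  have rg' := ho'.rank_lt (i + 2)
  have rh' := ho'.rank_lt (i + 1)
  have D : IsSplitting f g h (P ∪ Q) P Q := by
    refine ⟨hP.nonempty, hQ.nonempty, fun p => Finset.mem_union, ?_, ?_, ?_⟩
    · intro p hp q hq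
      rw [fP p hp, fQ q hq]
      have := rf p hp
      omega
    · intro p hp q hq
      rw [gP p hp, gQ q hq]
      have := rg' q hq
      omega
    · intro p hp
      rw [hP' p hp]
      by_cases hlt : o (i + 1) p < β
      · left
        intro q hq
        rw [if_pos hlt, hQ' q hq]
        omega
      · right
        intro q hq
        rw [if_neg hlt, hQ' q hq]
        have := rh' q hq
        omega
  have sfP : ∀ p ∈ P, ∀ q ∈ P, (o i p < o i q ↔ f p < f q) := fun p hp q hq => by
    rw [fP p hp, fP q hq]
  have sgP : ∀ p ∈ P, ∀ q ∈ P, (o (i + 2) p < o (i + 2) q ↔ g p < g q) := fun p hp q hq => by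
    rw [gP p hp, gP q hq]
    omega
  have shP : ∀ p ∈ P, ∀ q ∈ P, (o (i + 1) p < o (i + 1) q ↔ h p < h q) := fun p hp q hq => by
    rw [hP' p hp, hP' q hq]
    split_ifs <;> omega
  have sfQ : ∀ p ∈ Q, ∀ q ∈ Q, (o' i p < o' i q ↔ f p < f q) := fun p hp q hq => by
    rw [fQ p hp, fQ q hq]
    omega
  have sgQ : ∀ p ∈ Q, ∀ q ∈ Q, (o' (i + 2) p < o' (i + 2) q ↔ g p < g q) := fun p hp q hq => by
    rw [gQ p hp, gQ q hq]
  have shQ : ∀ p ∈ Q, ∀ q ∈ Q, (o' (i + 1) p < o' (i + 1) q ↔ h p < h q) := fun p hp q hq => by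
    rw [hQ' p hp, hQ' q hq]
    omega
  have TP := (isTriFamily_iff i).1 ho.family
  have TQ := (isTriFamily_iff i).1 ho'.family
  have T : IsTriOrder f g h (P ∪ Q) :=
    D.isTriOrder (TP.congr sfP sgP shP) (TQ.congr sfQ sgQ shQ)
  have ne1 : i + 1 ≠ i := by omega
  have ne2 : i + 2 ≠ i := by omega
  let o'' : Fin 3 → ℤ × ℤ → ℕ := fun j => if j = i then f else if j = i + 2 then g else h
  have o0 : o'' i = f := if_pos rfl
  have o2 : o'' (i + 2) = g := by simp [o'', ne2]
  have o1 : o'' (i + 1) = h := by simp [o'', ne1]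
  -- The ranks of `P` in the third order are `0, …, P.card - 1`, so `β` of them are below `β`.
  have rank : (P.filter fun p => o (i + 1) p < β).card = β := by
    have himg : P.image (o (i + 1)) = Finset.range P.card := by
      apply Finset.eq_of_subset_of_card_le
      · intro x hx
        obtain ⟨p, hp, rfl⟩ := Finset.mem_image.1 hx
        exact Finset.mem_range.2 (rh p hp)
      · rw [Finset.card_range, Finset.card_image_of_injOn TP.injh]
    have h1 : ((P.filter fun p => o (i + 1) p < β).image (o (i + 1))) = Finset.range β := by
      have := Finset.filter_image (s := P) (f := o (i + 1)) (p := (· < β))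
      rw [← this, himg]
      ext x
      simp only [Finset.mem_filter, Finset.mem_range]
      omega
    rw [← Finset.card_image_of_injOn (f := o (i + 1)), h1, Finset.card_range]
    exact TP.injh.mono (by exact_mod_cast Finset.filter_subset _ _)
  have below : ∀ q ∈ Q, (P.filter fun p => h p < h q).card = β := by
    intro q hq
    rw [← rank]
    refine congrArg Finset.card (Finset.filter_congr fun p hp => ?_)
    rw [hP' p hp, hQ' q hq]
    have := rh' q hq
    split_ifs <;> omega
  have above : ∀ q ∈ Q, ((P.filter fun p => h q < h p).card : ℤ) = w (i + 1) - u (i + 1) := by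
    intro q hq
    have := D.card_filter_add hq
    have := below q hq
    omega
  have D' : IsSplitting (o'' i) (o'' (i + 2)) (o'' (i + 1)) (P ∪ Q) P Q := by rwa [o0, o1, o2]
  have ii1 : i + 1 + 2 = i := by omega
  have ii2 : i + 2 + 2 = i + 1 := by omega
  refine ⟨o'', ?_, ?_, ?_⟩
  · rw [isTriFamily_iff i, o0, o1, o2]
    exact T
  · rw [forall_fin_three_iff i, o0, o1, o2, hcard]
    refine ⟨fun p hp => ?_, fun p hp => ?_, fun p hp => ?_⟩ <;>
      rcases Finset.mem_union.1 hp with hp | hp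
    · have := rf p hp
      rw [fP p hp]
      omega
    · have := rf' p hp
      rw [fQ p hp]
      omega
    · have := rh p hp
      rw [hP' p hp]
      split_ifs <;> omega
    · have := rh' p hp
      rw [hQ' p hp]
      omega
    · have := rg p hp
      rw [gP p hp]
      omega
    · have := rg' p hp
      rw [gQ p hp]
      omega
  · intro p hp
    rcases Finset.mem_union.1 hp with hp | hp
    · rw [isPlaced_left_iff D' (v := v) (by omega) e1 e2 hp]
      intro j
      rw [ho.placed p hp j]
      congr 2
      unfold triCount
      revert j
      rw [forall_fin_three_iff i, ii1, ii2, o0, o1, o2]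
      exact ⟨invCount_congr (fun j hj => sfP p hp j hj) (fun j hj => sgP j hj p hp),
        invCount_congr (fun j hj => shP p hp j hj) (fun j hj => sfP j hj p hp),
        invCount_congr (fun j hj => sgP p hp j hj) (fun j hj => shP j hj p hp)⟩
    · rw [isPlaced_right_iff D' (w := w) hp e0 (by rw [o1, above p hp]; ring)
        (by rw [o1, below p hp]; omega)]
      intro j
      rw [ho'.placed p hp j]
      congr 2
      unfold triCount
      revert j
      rw [forall_fin_three_iff i, ii1, ii2, o0, o1, o2]
      exact ⟨invCount_congr (fun j hj => sfQ p hp j hj) (fun j hj => sgQ j hj p hp),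
        invCount_congr (fun j hj => shQ p hp j hj) (fun j hj => sfQ j hj p hp),
        invCount_congr (fun j hj => sgQ p hp j hj) (fun j hj => shQ j hj p hp)⟩

theorem Builds.exists_isReading (h : Builds P u) : ∃ o, IsReading o P u := by
  induction h with
  | single p =>
    refine ⟨fun _ _ => 0, ⟨?_, ?_, ?_, ?_, ?_⟩, ?_, ?_⟩
    · simp
    · simp
    · simp
    · simp
    · simp
    · simp
    · intro q hq j
      rw [Finset.mem_singleton.1 hq]
      simp [triCount, invCount]
  | merge i hP hQ hm ihP ihQ =>
    obtain ⟨o, ho⟩ := ihP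
    obtain ⟨o', ho'⟩ := ihQ
    exact hm.exists_isReading hP hQ ho ho'

/-- Orders that place every cell of a merge on itself split along the merge: the cells of the
corner triangle have so many inversions that they come first in one order and last in another, and
extremal elements of the other part leave no room inside this part in the third order. -/
lemma IsMerge.isSplitting (hm : IsMerge i u v w) (hP : Builds P v) (hQ : Builds Q w)
    (ho : ∀ p ∈ P ∪ Q, IsPlaced o (P ∪ Q) u p p) :
    IsSplitting (o i) (o (i + 2)) (o (i + 1)) (P ∪ Q) P Q ∧
    ∀ q ∈ Q, ((P.filter fun p => o (i + 1) q < o (i + 1) p).card : ℤ) = w (i + 1) - u (i + 1) ∧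
      ((P.filter fun p => o (i + 1) p < o (i + 1) q).card : ℤ) = w (i + 2) - u (i + 2) := by
  have hd := hm.disjoint_finset hP hQ
  have cP := hP.card
  have cQ := hQ.card
  rw [← sum_rotate v i] at cP
  rw [← sum_rotate w i] at cQ
  obtain ⟨e0, e1, e2, l0, l1, l2, hs⟩ := hm
  have big : ∀ p ∈ P, Q.card ≤ invCount (o i) (o (i + 2)) (P ∪ Q) p := by
    intro p hp
    have h1 := ho p (Finset.mem_union_left _ hp) i
    have h2 := hP.subset hp i
    unfold triCount at h1
    omega
  -- Only elements of `Q` lie above the `o i`-largest element of `P`, and `Q.card` elements do.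
  have hf : ∀ p ∈ P, ∀ q ∈ Q, o i p < o i q := by
    obtain ⟨m, hm, hmax⟩ := P.exists_max_image (o i) hP.nonempty
    have hsub : (P ∪ Q).filter (fun j => o i m < o i j ∧ o (i + 2) j < o (i + 2) m) ⊆ Q := by
      intro j hj
      obtain ⟨h1, h2, h3⟩ := Finset.mem_filter.1 hj
      rcases Finset.mem_union.1 h1 with h1 | h1
      · exact absurd h2 (not_lt.2 (hmax j h1))
      · exact h1
    have heq := Finset.eq_of_subset_of_card_le hsub (big m hm)
    intro p hp q hq
    rw [← heq] at hq
    exact (hmax p hp).trans_lt (Finset.mem_filter.1 hq).2.1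
  have hg : ∀ p ∈ P, ∀ q ∈ Q, o (i + 2) q < o (i + 2) p := by
    obtain ⟨m, hm, hmin⟩ := P.exists_min_image (o (i + 2)) hP.nonempty
    have hsub : (P ∪ Q).filter (fun j => o i m < o i j ∧ o (i + 2) j < o (i + 2) m) ⊆ Q := by
      intro j hj
      obtain ⟨h1, h2, h3⟩ := Finset.mem_filter.1 hj
      rcases Finset.mem_union.1 h1 with h1 | h1
      · exact absurd h3 (not_lt.2 (hmin j h1))
      · exact h1
    have heq := Finset.eq_of_subset_of_card_le hsub (big m hm)
    intro p hp q hq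
    rw [← heq] at hq
    exact (Finset.mem_filter.1 hq).2.2.trans_le (hmin p hp)
  have ii1 : i + 1 + 2 = i := by omega
  have ii2 : i + 2 + 2 = i + 1 := by omega
  obtain ⟨M, hM, hmax⟩ := Q.exists_max_image (o (i + 1)) hQ.nonempty
  obtain ⟨m, hm, hmin⟩ := Q.exists_min_image (o (i + 1)) hQ.nonempty
  -- An element of `Q` that is extremal in the third order has all its inversions with `P`.
  have hα : w (i + 1) - u (i + 1) ≤ (P.filter fun p => o (i + 1) M < o (i + 1) p).card := by
    have h1 := ho M (Finset.mem_union_right _ hM) (i + 1)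
    have h2 := hQ.subset hM (i + 1)
    unfold triCount at h1
    have h3 : invCount (o (i + 1)) (o (i + 1 + 2)) (P ∪ Q) M ≤
        (P.filter fun p => o (i + 1) M < o (i + 1) p).card := by
      refine Finset.card_le_card fun j hj => ?_
      obtain ⟨h1, h2, h3⟩ := Finset.mem_filter.1 hj
      rcases Finset.mem_union.1 h1 with h1 | h1
      · exact Finset.mem_filter.2 ⟨h1, h2⟩
      · exact absurd h2 (not_lt.2 (hmax j h1))
    omega
  have hβ : w (i + 2) - u (i + 2) ≤ (P.filter fun p => o (i + 1) p < o (i + 1) m).card := by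
    have h1 := ho m (Finset.mem_union_right _ hm) (i + 2)
    have h2 := hQ.subset hm (i + 2)
    unfold triCount at h1
    rw [ii2] at h1
    have h3 : invCount (o (i + 2)) (o (i + 1)) (P ∪ Q) m ≤
        (P.filter fun p => o (i + 1) p < o (i + 1) m).card := by
      refine Finset.card_le_card fun j hj => ?_
      obtain ⟨h1, h2, h3⟩ := Finset.mem_filter.1 hj
      rcases Finset.mem_union.1 h1 with h1 | h1
      · exact Finset.mem_filter.2 ⟨h1, h3⟩
      · exact absurd h3 (not_lt.2 (hmin j h1))
    omega
  have hmM : o (i + 1) m ≤ o (i + 1) M := hmin M hM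
  have hdis : Disjoint (P.filter fun p => o (i + 1) M < o (i + 1) p)
      (P.filter fun p => o (i + 1) p < o (i + 1) m) :=
    Finset.disjoint_left.2 fun p h1 h2 => by
      have := (Finset.mem_filter.1 h1).2
      have := (Finset.mem_filter.1 h2).2
      omega
  have hcu := Finset.card_union_of_disjoint hdis
  have hsub : (P.filter fun p => o (i + 1) M < o (i + 1) p) ∪
      (P.filter fun p => o (i + 1) p < o (i + 1) m) ⊆ P :=
    Finset.union_subset (Finset.filter_subset _ _) (Finset.filter_subset _ _)
  have hle := Finset.card_le_card hsub
  have heq := Finset.eq_of_subset_of_card_le hsub (by omega)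
  have hh : ∀ p ∈ P, o (i + 1) M < o (i + 1) p ∨ o (i + 1) p < o (i + 1) m := by
    intro p hp
    rw [← heq] at hp
    rcases Finset.mem_union.1 hp with h | h
    · exact Or.inl (Finset.mem_filter.1 h).2
    · exact Or.inr (Finset.mem_filter.1 h).2
  refine ⟨⟨hP.nonempty, hQ.nonempty, fun p => Finset.mem_union, hf, hg, ?_⟩, ?_⟩
  · intro p hp
    rcases hh p hp with h | h
    · exact Or.inr fun q hq => (hmax q hq).trans_lt h
    · exact Or.inl fun q hq => h.trans_le (hmin q hq)
  · intro q hq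
    have h1 := hmax q hq
    have h2 := hmin q hq
    have e1 : (P.filter fun p => o (i + 1) q < o (i + 1) p) =
        P.filter fun p => o (i + 1) M < o (i + 1) p :=
      Finset.filter_congr fun p hp => by have := hh p hp; omega
    have e2 : (P.filter fun p => o (i + 1) p < o (i + 1) q) =
        P.filter fun p => o (i + 1) p < o (i + 1) m :=
      Finset.filter_congr fun p hp => by have := hh p hp; omega
    rw [e1, e2]
    omega

/-- If `h` and `h'` order `P` in the same way and `q` has at least as many elements of `P` below it
for `h'` as for `h`, then all elements below `q` for `h` are so for `h'`. -/
lemma le_of_card_filter_le {X : Type*} {h h' : X → ℕ} {P : Finset X} {p q : X} (hp : p ∈ P)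
    (hhh : ∀ a ∈ P, ∀ b ∈ P, (h a < h b ↔ h' a < h' b))
    (hcard : (P.filter fun a => h a < h q).card ≤ (P.filter fun a => h' a < h' q).card)
    (hpq : h p < h q) : h' p ≤ h' q := by
  by_contra hlt
  refine absurd hcard (not_le.2 (Finset.card_lt_card ⟨?_, ?_⟩))
  · intro a ha
    obtain ⟨h1, h2⟩ := Finset.mem_filter.1 ha
    have := (hhh a h1 p hp).2 (by omega)
    exact Finset.mem_filter.2 ⟨h1, by omega⟩
  · intro hs
    have := (Finset.mem_filter.1 (hs (Finset.mem_filter.2 ⟨hp, hpq⟩))).2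
    omega

/-- The orders are determined by a building set: they are recovered from the merges. -/
theorem Builds.order_unique (h : Builds P u) (ho : ∀ p ∈ P, IsPlaced o P u p p)
    (ho' : ∀ p ∈ P, IsPlaced o' P u p p) (j : Fin 3) :
    ∀ p ∈ P, ∀ q ∈ P, (o j p < o j q ↔ o' j p < o' j q) := by
  induction h generalizing j with
  | single p =>
    intro q hq r hr
    rw [Finset.mem_singleton.1 hq, Finset.mem_singleton.1 hr]
    simp
  | @merge i P Q u v w hP hQ hm ihP ihQ =>
    obtain ⟨D, hc⟩ := hm.isSplitting hP hQ ho
    obtain ⟨D', hc'⟩ := hm.isSplitting hP hQ ho'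
    have cQ := hQ.card
    rw [← sum_rotate w i] at cQ
    have hm' := hm
    obtain ⟨e0, e1, e2, l0, l1, l2, hs⟩ := hm'
    have IP := ihP
      (fun p hp => (isPlaced_left_iff D (by omega) e1 e2 hp).1 (ho p (Finset.mem_union_left _ hp)))
      (fun p hp =>
        (isPlaced_left_iff D' (by omega) e1 e2 hp).1 (ho' p (Finset.mem_union_left _ hp)))
    have IQ := ihQ
      (fun p hp => (isPlaced_right_iff D hp e0 (by rw [(hc p hp).1]; ring)
        (by rw [(hc p hp).2]; ring)).1 (ho p (Finset.mem_union_right _ hp)))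
      (fun p hp => (isPlaced_right_iff D' hp e0 (by rw [(hc' p hp).1]; ring)
        (by rw [(hc' p hp).2]; ring)).1 (ho' p (Finset.mem_union_right _ hp)))
    have cross : ∀ j, ∀ p ∈ P, ∀ q ∈ Q, (o j p < o j q ↔ o' j p < o' j q) ∧
        (o j q < o j p ↔ o' j q < o' j p) := by
      rw [forall_fin_three_iff i]
      refine ⟨?_, ?_, ?_⟩
      · intro p hp q hq
        have := D.lt_f p hp q hq
        have := D'.lt_f p hp q hq
        omega
      · intro p hp q hq
        have h1 := D.module_h p hp
        have h1' := D'.module_h p hp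
        have h2 := (hc q hq).2
        have h2' := (hc' q hq).2
        have h3 := le_of_card_filter_le hp (IP (i + 1)) (q := q) (by omega)
        have h3' := le_of_card_filter_le hp (fun a ha b hb => (IP (i + 1) a ha b hb).symm) (q := q)
          (by omega)
        rcases h1 with h1 | h1 <;> rcases h1' with h1' | h1' <;>
          have := h1 q hq <;> have := h1' q hq <;> omega
      · intro p hp q hq
        have := D.lt_g p hp q hq
        have := D'.lt_g p hp q hq
        omega
    intro p hp q hq
    rcases Finset.mem_union.1 hp with hp | hp <;> rcases Finset.mem_union.1 hq with hq | hq
    · exact IP j p hp q hq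
    · exact (cross j p hp q hq).1
    · exact (cross j q hq p hp).2
    · exact IQ j p hp q hq

end Reading

/-! ### Closure under completing windows -/

/-- `D` contains the third cell of a window as soon as it contains two of them. -/
def IsWindowClosed (D : Set (ℤ × ℤ)) : Prop :=
  ∀ (v : ℤ × ℤ) (k : Fin 3), (∀ j, j ≠ k → v + windowCell j ∈ D) → v + windowCell k ∈ D

lemma bary_add_windowCell (i j : Fin 3) (v : ℤ × ℤ) :
    bary i (v + windowCell j) = bary i v + (if i = j then 1 else 0) - (if i = 0 then 1 else 0) := by
  fin_cases i <;> fin_cases j <;> simp [bary, windowCell] <;> ring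

/-- The cell with coordinate `i` equal to `d` and coordinate `i + 1` equal to `m`. -/
def rowCell (i : Fin 3) (d m : ℤ) : ℤ × ℤ := ![(m, -d - m), (d, m), (-d - m, d)] i

lemma bary_rowCell (i : Fin 3) (d m : ℤ) : bary i (rowCell i d m) = d ∧
    bary (i + 1) (rowCell i d m) = m ∧ bary (i + 2) (rowCell i d m) = -d - m := by
  fin_cases i <;> simp [bary, rowCell]
  ring

lemma bary_injective {p q : ℤ × ℤ} (i : Fin 3) (h0 : bary i p = bary i q)
    (h1 : bary (i + 1) p = bary (i + 1) q) : p = q := by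
  fin_cases i <;> simp [bary] at h0 h1 <;> ext <;> omega

lemma rowCell_bary (i : Fin 3) (p : ℤ × ℤ) : rowCell i (bary i p) (bary (i + 1) p) = p :=
  bary_injective i (bary_rowCell i _ _).1 (bary_rowCell i _ _).2.1

lemma exists_window_eq_rowCell (i : Fin 3) (d m : ℤ) : ∃ v : ℤ × ℤ,
    v + windowCell i = rowCell i (d + 1) m ∧ v + windowCell (i + 1) = rowCell i d (m + 1) ∧
      v + windowCell (i + 2) = rowCell i d m := by
  refine ⟨rowCell i (d + 1) m - windowCell i, ?_⟩
  fin_cases i <;> simp [rowCell, windowCell] <;> ring_nf <;> simp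

lemma exists_rowCell_eq_window (i : Fin 3) (v : ℤ × ℤ) : ∃ d m : ℤ,
    v + windowCell i = rowCell i (d + 1) m ∧ v + windowCell (i + 1) = rowCell i d (m + 1) ∧
      v + windowCell (i + 2) = rowCell i d m := by
  refine ⟨bary i (v + windowCell i) - 1, bary (i + 1) (v + windowCell i), ?_⟩
  fin_cases i <;> simp [rowCell, windowCell, bary, Prod.ext_iff] <;> ring_nf <;> simp

lemma mem_baryTriangle_rowCell {i : Fin 3} {u : Fin 3 → ℤ} {d m : ℤ} :
    rowCell i d m ∈ baryTriangle u ↔ u i ≤ d ∧ u (i + 1) ≤ m ∧ u (i + 2) ≤ -d - m := by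
  rw [mem_baryTriangle_iff i, (bary_rowCell i d m).1, (bary_rowCell i d m).2.1,
    (bary_rowCell i d m).2.2]

lemma isWindowClosed_baryTriangle (u : Fin 3 → ℤ) : IsWindowClosed (baryTriangle u) := by
  intro v k h i
  obtain ⟨j, hjk, hji⟩ : ∃ j : Fin 3, j ≠ k ∧ j ≠ i := by
    clear h
    revert k
    revert i
    decide
  have := h j hjk i
  rw [bary_add_windowCell, if_neg hji.symm] at this
  rw [bary_add_windowCell]
  split_ifs at * <;> omega

section Closed

variable {D : Set (ℤ × ℤ)}

lemma IsWindowClosed.up (hD : IsWindowClosed D) {i : Fin 3} {d m : ℤ} (h1 : rowCell i d (m + 1) ∈ D)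
    (h2 : rowCell i d m ∈ D) : rowCell i (d + 1) m ∈ D := by
  obtain ⟨v, e0, e1, e2⟩ := exists_window_eq_rowCell i d m
  rw [← e0]
  refine hD v i fun j hj => ?_
  obtain rfl | rfl : j = i + 1 ∨ j = i + 2 := by omega
  · rwa [e1]
  · rwa [e2]

lemma IsWindowClosed.right (hD : IsWindowClosed D) {i : Fin 3} {d m : ℤ}
    (h1 : rowCell i (d + 1) m ∈ D) (h2 : rowCell i d m ∈ D) : rowCell i d (m + 1) ∈ D := by
  obtain ⟨v, e0, e1, e2⟩ := exists_window_eq_rowCell i d m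
  rw [← e1]
  refine hD v (i + 1) fun j hj => ?_
  obtain rfl | rfl : j = i ∨ j = i + 2 := by omega
  · rwa [e0]
  · rwa [e2]

lemma IsWindowClosed.left (hD : IsWindowClosed D) {i : Fin 3} {d m : ℤ}
    (h1 : rowCell i (d + 1) m ∈ D) (h2 : rowCell i d (m + 1) ∈ D) : rowCell i d m ∈ D := by
  obtain ⟨v, e0, e1, e2⟩ := exists_window_eq_rowCell i d m
  rw [← e2]
  refine hD v (i + 2) fun j hj => ?_
  obtain rfl | rfl : j = i ∨ j = i + 1 := by omega
  · rwa [e0]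
  · rwa [e1]

/-- One side of a triangle generates the triangle. -/
lemma IsWindowClosed.baryTriangle_subset_of_side (hD : IsWindowClosed D) {u : Fin 3 → ℤ} (i : Fin 3)
    (h : ∀ p ∈ baryTriangle u, bary i p = u i → p ∈ D) : baryTriangle u ⊆ D := by
  have key : ∀ k : ℕ, ∀ m : ℤ, rowCell i (u i + k) m ∈ baryTriangle u →
      rowCell i (u i + k) m ∈ D := by
    intro k
    induction k with
    | zero =>
      intro m hm
      exact h _ hm (by rw [(bary_rowCell i _ m).1]; simp)
    | succ k ih =>
      intro m hm
      rw [mem_baryTriangle_rowCell] at hm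
      push_cast at hm ⊢
      rw [← add_assoc]
      exact hD.up (ih _ (mem_baryTriangle_rowCell.2 (by omega)))
        (ih _ (mem_baryTriangle_rowCell.2 (by omega)))
  intro p hp
  have h0 := hp i
  have := key (bary i p - u i).toNat (bary (i + 1) p)
  rw [show u i + ((bary i p - u i).toNat : ℤ) = bary i p by omega, rowCell_bary] at this
  exact this hp

/-- The two triangles of a merge generate the merged triangle, row by row. -/
lemma IsWindowClosed.baryTriangle_subset_of_isMerge (hD : IsWindowClosed D) {i : Fin 3}
    {u v w : Fin 3 → ℤ} (hm : IsMerge i u v w) (hv : baryTriangle v ⊆ D) (hw : baryTriangle w ⊆ D) :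
    baryTriangle u ⊆ D := by
  obtain ⟨e0, e1, e2, l0, l1, l2, hs⟩ := hm
  have key : ∀ k : ℕ, ∀ m : ℤ, rowCell i (v i - k) m ∈ baryTriangle u →
      rowCell i (v i - k) m ∈ D := by
    intro k
    induction k with
    | zero =>
      intro m hm
      refine hv ?_
      rw [mem_baryTriangle_rowCell] at hm ⊢
      omega
    | succ k ih =>
      set d : ℤ := v i - (k + 1 : ℕ) with hd
      have hdk : v i - k = d + 1 := by omega
      rw [hdk] at ih
      have seed : rowCell i d (w (i + 1)) ∈ baryTriangle u → rowCell i d (w (i + 1)) ∈ D := by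
        intro h
        rw [mem_baryTriangle_rowCell] at h
        exact hw (mem_baryTriangle_rowCell.2 (by omega))
      have goR : ∀ j : ℕ, rowCell i d (w (i + 1) + j) ∈ baryTriangle u →
          rowCell i d (w (i + 1) + j) ∈ D := by
        intro j
        induction j with
        | zero => simpa using seed
        | succ j ihj =>
          intro h
          push_cast at h ⊢
          rw [← add_assoc] at h ⊢
          rw [mem_baryTriangle_rowCell] at h
          exact hD.right (ih _ (mem_baryTriangle_rowCell.2 (by omega)))
            (ihj (mem_baryTriangle_rowCell.2 (by omega)))
      have goL : ∀ j : ℕ, rowCell i d (w (i + 1) - j) ∈ baryTriangle u →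
          rowCell i d (w (i + 1) - j) ∈ D := by
        intro j
        induction j with
        | zero => simpa using seed
        | succ j ihj =>
          intro h
          rw [mem_baryTriangle_rowCell] at h
          refine hD.left (ih _ (mem_baryTriangle_rowCell.2 (by omega))) ?_
          rw [show w (i + 1) - ((j + 1 : ℕ) : ℤ) + 1 = w (i + 1) - j by push_cast; ring]
          exact ihj (mem_baryTriangle_rowCell.2 (by omega))
      intro m hm
      rcases le_total (w (i + 1)) m with h | h
      · have := goR (m - w (i + 1)).toNat
        rw [show w (i + 1) + ((m - w (i + 1)).toNat : ℤ) = m by omega] at this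
        exact this hm
      · have := goL (w (i + 1) - m).toNat
        rw [show w (i + 1) - ((w (i + 1) - m).toNat : ℤ) = m by omega] at this
        exact this hm
  intro p hp
  rcases le_total (v i) (bary i p) with h | h
  · refine hv ((mem_baryTriangle_iff i).2 ?_)
    have := (mem_baryTriangle_iff i).1 hp
    omega
  · have := key (v i - bary i p).toNat (bary (i + 1) p)
    rw [show v i - ((v i - bary i p).toNat : ℤ) = bary i p by omega, rowCell_bary] at this
    exact this hp

lemma Builds.baryTriangle_subset (hD : IsWindowClosed D) {P : Finset (ℤ × ℤ)} {u : Fin 3 → ℤ}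
    (h : Builds P u) (hP : (P : Set (ℤ × ℤ)) ⊆ D) : baryTriangle u ⊆ D := by
  induction h with
  | single p =>
    intro q hq
    have h0 := hq 0
    have h1 := hq 1
    have h2 := hq 2
    simp only [bary_zero, bary_one, bary_two] at h0 h1 h2
    have : q = p := by ext <;> omega
    rw [this]
    exact hP (by simp)
  | merge i _ _ hm ihP ihQ =>
    rw [Finset.coe_union, Set.union_subset_iff] at hP
    exact hD.baryTriangle_subset_of_isMerge hm (ihP hP.1) (ihQ hP.2)

end Closed

/-! ### Colorings for totally extremally permutive rules -/

/-- Two-sided recursion along a relation that can be solved in both directions. -/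
lemma exists_int_rec {β : Type*} (r : ℤ → β → β → Prop) (n₀ : ℤ) (b₀ : β)
    (hf : ∀ n, n₀ ≤ n → ∀ b, ∃ b', r n b b') (hb : ∀ n, n < n₀ → ∀ b', ∃ b, r n b b') :
    ∃ s : ℤ → β, s n₀ = b₀ ∧ ∀ n, r n (s n) (s (n + 1)) := by
  have : Nonempty β := ⟨b₀⟩
  choose! F hF using hf
  choose! G hG using hb
  let up : ℕ → β := fun k => Nat.rec b₀ (fun k b => F (n₀ + k) b) k
  let dn : ℕ → β := fun k => Nat.rec b₀ (fun k b => G (n₀ - k - 1) b) k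
  refine ⟨fun n => if n₀ ≤ n then up (n - n₀).toNat else dn (n₀ - n).toNat, by simp [up], ?_⟩
  intro n
  by_cases h : n₀ ≤ n
  · obtain ⟨k, rfl⟩ := Int.le.dest h
    have e1 : (n₀ + (k : ℤ) - n₀).toNat = k := by omega
    have e2 : (n₀ + (k : ℤ) + 1 - n₀).toNat = k + 1 := by omega
    simp only [h, if_true, e1, e2, show n₀ ≤ n₀ + (k : ℤ) + 1 by omega]
    exact hF _ h _
  · obtain ⟨k, hk⟩ : ∃ k : ℕ, n = n₀ - k - 1 := ⟨(n₀ - n - 1).toNat, by omega⟩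
    subst hk
    have e1 : (n₀ - (n₀ - (k : ℤ) - 1)).toNat = k + 1 := by omega
    simp only [h, if_false, e1]
    have hr : r (n₀ - k - 1) (dn (k + 1)) (dn k) := hG _ (by omega) _
    split_ifs with h'
    · have hk0 : k = 0 := by omega
      subst hk0
      have e2 : (n₀ - ((0 : ℕ) : ℤ) - 1 + 1 - n₀).toNat = 0 := by omega
      rw [e2]
      exact hr
    · have e2 : (n₀ - (n₀ - (k : ℤ) - 1 + 1)).toNat = k := by omega
      rw [e2]
      exact hr

section Coloring

variable {A : Type*} {R : Set (Fin 3 → A)}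

/-- The coloring `t` of the whole plane carries an allowed pattern in every window. -/
def IsConfig (R : Set (Fin 3 → A)) (t : ℤ × ℤ → A) : Prop :=
  ∀ v : ℤ × ℤ, (fun k => t (v + windowCell k)) ∈ R

lemma IsTEP.eq_of_forall_ne (hR : IsTEP R) {w w' : Fin 3 → A} (hw : w ∈ R) (hw' : w' ∈ R)
    (k : Fin 3) (h : ∀ j, j ≠ k → w j = w' j) : w k = w' k := by
  obtain ⟨a, -, ha⟩ := hR k w
  have h1 : Function.update w k (w k) ∈ R := by rwa [Function.update_eq_self]
  have h2 : Function.update w k (w' k) ∈ R := by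
    convert hw' using 1
    funext j
    by_cases e : j = k
    · subst e
      simp
    · simp [e, h j e]
  exact (ha _ h1).trans (ha _ h2).symm

/-- Two configurations agree on a set that is closed under completing windows. -/
lemma IsTEP.isWindowClosed_eq (hR : IsTEP R) {t t' : ℤ × ℤ → A} (ht : IsConfig R t)
    (ht' : IsConfig R t') : IsWindowClosed {p | t p = t' p} := fun v k h =>
  hR.eq_of_forall_ne (ht v) (ht' v) k h

/-- A configuration is found from its values on one row and at one cell of each lower row. -/
lemma IsTEP.exists_isConfig (hR : IsTEP R) (i : Fin 3) (d₀ : ℤ) (l : ℤ → A) (pos : ℤ → ℤ)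
    (val : ℤ → A) : ∃ t, IsConfig R t ∧ (∀ m, t (rowCell i d₀ m) = l m) ∧
      ∀ d < d₀, t (rowCell i d (pos d)) = val d := by
  have ne1 : i + 1 ≠ i := by omega
  have ne2 : i + 2 ≠ i := by omega
  have ne3 : i + 2 ≠ i + 1 := by omega
  let pat : A → A → A → Fin 3 → A := fun a b c k => if k = i then a else if k = i + 1 then b else c
  have ex0 : ∀ b c, ∃ a, pat a b c ∈ R := by
    intro b c
    obtain ⟨a, ha, -⟩ := hR i (pat b b c)
    refine ⟨a, ?_⟩
    convert ha using 1
    funext k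
    by_cases e : k = i <;> simp [pat, Function.update, e]
  have ex1 : ∀ a c, ∃ b, pat a b c ∈ R := by
    intro a c
    obtain ⟨b, hb, -⟩ := hR (i + 1) (pat a a c)
    refine ⟨b, ?_⟩
    convert hb using 1
    funext k
    by_cases e : k = i + 1
    · subst e
      simp [pat]
    · simp [pat, Function.update, e]
  have ex2 : ∀ a b, ∃ c, pat a b c ∈ R := by
    intro a b
    obtain ⟨c, hc, -⟩ := hR (i + 2) (pat a b a)
    refine ⟨c, ?_⟩
    convert hc using 1
    funext k
    by_cases e : k = i + 2
    · subst e
      simp [pat]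
    · have : k = i ∨ k = i + 1 := by omega
      rcases this with rfl | rfl <;> simp [pat, Function.update]
  obtain ⟨s, hs0, hs⟩ := exists_int_rec (β := ℤ → A)
    (fun d x y => (∀ m, pat (y m) (x (m + 1)) (x m) ∈ R) ∧ (d < d₀ → x (pos d) = val d)) d₀ l
    (fun d hd x => by
      choose y hy using fun m => ex0 (x (m + 1)) (x m)
      exact ⟨y, hy, fun h => absurd h (not_lt.2 hd)⟩)
    (fun d _ y => by
      obtain ⟨x, hx0, hx⟩ := exists_int_rec (fun m b c => pat (y m) c b ∈ R) (pos d) (val d)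
        (fun m _ b => ex1 (y m) b) (fun m _ b => ex2 (y m) b)
      exact ⟨x, hx, fun _ => hx0⟩)
  refine ⟨fun p => s (bary i p) (bary (i + 1) p), ?_, ?_, ?_⟩
  · intro v
    obtain ⟨d, m, e0, e1, e2⟩ := exists_rowCell_eq_window i v
    convert (hs d).1 m using 1
    funext k
    obtain rfl | rfl | rfl : k = i ∨ k = i + 1 ∨ k = i + 2 := by omega
    · simp [pat, e0, bary_rowCell]
    · simp [pat, e1, bary_rowCell]
    · simp [pat, e2, bary_rowCell]
  · intro m
    simp [bary_rowCell, hs0]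
  · intro d hd
    simp only [bary_rowCell]
    exact (hs d).2 hd

end Coloring

section Basis

variable {A : Type*} {R : Set (Fin 3 → A)}

/-- Configurations prescribed on the two triangles of a merge can be glued: the row of the corner
triangle facing the other triangle and one side of the latter determine a configuration. -/
lemma IsTEP.exists_isConfig_of_isMerge (hR : IsTEP R) {i : Fin 3} {u v w : Fin 3 → ℤ}
    (hm : IsMerge i u v w) {t₁ t₂ : ℤ × ℤ → A} (h₁ : IsConfig R t₁) (h₂ : IsConfig R t₂) :
    ∃ t, IsConfig R t ∧ (∀ p ∈ baryTriangle v, t p = t₁ p) ∧ ∀ p ∈ baryTriangle w, t p = t₂ p := by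
  obtain ⟨e0, e1, e2, l0, l1, l2, hs⟩ := hm
  obtain ⟨t, ht, htr, htc⟩ := hR.exists_isConfig i (v i) (fun m => t₁ (rowCell i (v i) m))
    (fun _ => w (i + 1)) (fun d => t₂ (rowCell i d (w (i + 1))))
  refine ⟨t, ht, fun p hp => ?_, fun p hp => ?_⟩
  · refine (hR.isWindowClosed_eq ht h₁).baryTriangle_subset_of_side i (fun q hq hqi => ?_) hp
    rw [← rowCell_bary i q, hqi]
    exact htr _
  · refine (hR.isWindowClosed_eq ht h₂).baryTriangle_subset_of_side (i + 1) (fun q hq hqi => ?_) hp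
    have hsum := bary_sum q i
    have hq' := (mem_baryTriangle_iff i).1 hq
    rw [← rowCell_bary i q, hqi]
    exact htc _ (by omega)

lemma IsTEP.exists_isConfig_apply_eq (hR : IsTEP R) (p : ℤ × ℤ) (a : A) :
    ∃ t, IsConfig R t ∧ t p = a := by
  obtain ⟨t, ht, htr, -⟩ := hR.exists_isConfig 1 (bary 1 p) (fun _ => a) (fun _ => 0) (fun _ => a)
  refine ⟨t, ht, ?_⟩
  rw [← rowCell_bary 1 p]
  exact htr _

/-- The symbols of a building set can be chosen freely. -/
theorem Builds.exists_isConfig (hR : IsTEP R) {P : Finset (ℤ × ℤ)} {u : Fin 3 → ℤ}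
    (h : Builds P u) (c : ℤ × ℤ → A) : ∃ t, IsConfig R t ∧ ∀ p ∈ P, t p = c p := by
  induction h with
  | single p =>
    obtain ⟨t, ht, hp⟩ := hR.exists_isConfig_apply_eq p (c p)
    exact ⟨t, ht, fun q hq => by rw [Finset.mem_singleton.1 hq, hp]⟩
  | merge i hP hQ hm ihP ihQ =>
    obtain ⟨t₁, h₁, e₁⟩ := ihP
    obtain ⟨t₂, h₂, e₂⟩ := ihQ
    obtain ⟨t, ht, et₁, et₂⟩ := hR.exists_isConfig_of_isMerge hm h₁ h₂
    refine ⟨t, ht, fun p hp => ?_⟩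
    rcases Finset.mem_union.1 hp with hp | hp
    · rw [et₁ p (hP.subset hp), e₁ p hp]
    · rw [et₂ p (hQ.subset hp), e₂ p hp]

lemma Deduces.mem {P : Set (ℤ × ℤ)} {c : P → A} {D : Set (ℤ × ℤ)} (hD : IsWindowClosed D)
    (hP : P ⊆ D) {v : ℤ × ℤ} {a : A} (h : Deduces R c v a) : v ∈ D := by
  induction h with
  | base v => exact hP v.2
  | step v k w hw h ih => exact hD v k ih

lemma Deduces.eq (hR : IsTEP R) {P : Set (ℤ × ℤ)} {c : P → A} {t : ℤ × ℤ → A}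
    (ht : IsConfig R t) (hc : ∀ p : P, c p = t p) {v : ℤ × ℤ} {a : A} (h : Deduces R c v a) :
    a = t v := by
  induction h with
  | base v => exact hc v
  | step v k w hw h ih => exact hR.eq_of_forall_ne hw (ht v) k ih

/-- The cells to which deduction assigns their symbol in a fixed configuration are closed under
completing windows. -/
lemma isWindowClosed_deduces {P : Set (ℤ × ℤ)} (c : P → A) {t : ℤ × ℤ → A} (ht : IsConfig R t) :
    IsWindowClosed {p | Deduces R c p (t p)} := fun v k h => Deduces.step v k _ (ht v) h

/-- A building set is a basis: the configuration extending its symbols is what deduction finds. -/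
theorem Builds.isTriangleBasis (hR : IsTEP R) {P : Finset (ℤ × ℤ)} {n : ℕ}
    (h : Builds P ![1 - (n : ℤ), 0, 0]) : IsTriangleBasis R n (P : Set (ℤ × ℤ)) := by
  classical
  intro c
  obtain ⟨q, hq⟩ := h.nonempty
  obtain ⟨t, ht, htc⟩ := h.exists_isConfig hR
    (fun p => if hp : p ∈ (P : Set (ℤ × ℤ)) then c ⟨p, hp⟩ else c ⟨q, hq⟩)
  have hc : ∀ p : (P : Set (ℤ × ℤ)), c p = t p := fun p => by
    rw [htc p p.2, dif_pos p.2]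
  refine ⟨t, fun v _ => ht v, fun v a => ⟨fun hd => ⟨?_, hd.eq hR ht hc⟩, ?_⟩⟩
  · rw [triangle_eq_baryTriangle]
    exact hd.mem (isWindowClosed_baryTriangle _) h.subset
  · rintro ⟨hv, rfl⟩
    rw [triangle_eq_baryTriangle] at hv
    refine h.baryTriangle_subset (isWindowClosed_deduces c ht) (fun p hp => ?_) hv
    change Deduces R c p (t p)
    rw [← hc ⟨p, hp⟩]
    exact Deduces.base ⟨p, hp⟩

/-! ### Every basis builds the triangle -/

/-- The sum of the larger coordinate bounds of two triangles: at most `0` if they intersect, `1` if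
they are disjoint and touch, larger if they are apart. -/
def gap (u v : Fin 3 → ℤ) : ℤ := max (u 0) (v 0) + max (u 1) (v 1) + max (u 2) (v 2)

lemma gap_nonpos_of_mem {u v : Fin 3 → ℤ} {p : ℤ × ℤ} (hu : p ∈ baryTriangle u)
    (hv : p ∈ baryTriangle v) : gap u v ≤ 0 := by
  have h0 := max_le (hu 0) (hv 0)
  have h1 := max_le (hu 1) (hv 1)
  have h2 := max_le (hu 2) (hv 2)
  simp only [bary_zero, bary_one, bary_two] at h0 h1 h2
  unfold gap
  omega

lemma exists_mem_of_gap_nonpos {u v : Fin 3 → ℤ} (h : gap u v ≤ 0) :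
    ∃ p, p ∈ baryTriangle u ∧ p ∈ baryTriangle v := by
  unfold gap at h
  have h0 := le_max_left (u 0) (v 0)
  have h0' := le_max_right (u 0) (v 0)
  refine ⟨(max (u 1) (v 1), max (u 2) (v 2)), ?_, ?_⟩ <;> intro i <;> fin_cases i <;>
    simp [bary] <;> omega

/-- Cells of two triangles in a common window force the triangles to intersect or touch. -/
lemma gap_le_one_of_window {u w : Fin 3 → ℤ} {v : ℤ × ℤ} {j k : Fin 3}
    (hu : v + windowCell j ∈ baryTriangle u) (hw : v + windowCell k ∈ baryTriangle w) :
    gap u w ≤ 1 := by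
  have e : ∀ i, max (u i) (w i) ≤ bary i v + (if i = j then 1 else 0) + (if i = k then 1 else 0) -
      (if i = 0 then 1 else 0) := by
    intro i
    have h1 := hu i
    have h2 := hw i
    rw [bary_add_windowCell] at h1 h2
    refine max_le ?_ ?_ <;> split_ifs at * <;> omega
  have e0 := e 0
  have e1 := e 1
  have e2 := e 2
  simp only [bary_zero, bary_one, bary_two] at e0 e1 e2
  have sj : (if (0 : Fin 3) = j then (1 : ℤ) else 0) + (if (1 : Fin 3) = j then 1 else 0) +
      (if (2 : Fin 3) = j then 1 else 0) = 1 := by fin_cases j <;> simp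
  have sk : (if (0 : Fin 3) = k then (1 : ℤ) else 0) + (if (1 : Fin 3) = k then 1 else 0) +
      (if (2 : Fin 3) = k then 1 else 0) = 1 := by fin_cases k <;> simp
  norm_num at e0 e1 e2
  unfold gap
  omega

/-- Disjoint touching triangles form a merge. -/
lemma exists_isMerge_of_gap_eq_one {u v : Fin 3 → ℤ} (hu : u 0 + u 1 + u 2 ≤ 0)
    (hv : v 0 + v 1 + v 2 ≤ 0) (h : gap u v = 1) :
    ∃ i x, IsMerge i x u v ∨ IsMerge i x v u := by
  unfold gap at h
  have main : ∃ i : Fin 3, (v i ≤ u i ∧ u (i + 1) ≤ v (i + 1) ∧ u (i + 2) ≤ v (i + 2)) ∨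
      (u i ≤ v i ∧ v (i + 1) ≤ u (i + 1) ∧ v (i + 2) ≤ u (i + 2)) := by
    by_contra hc
    push Not at hc
    have h0 := hc 0
    have h1 := hc 1
    have h2 := hc 2
    simp only [zero_add, show (1 + 1 : Fin 3) = 2 from rfl, show (1 + 2 : Fin 3) = 0 from rfl,
      show (2 + 1 : Fin 3) = 0 from rfl, show (2 + 2 : Fin 3) = 1 from rfl] at h0 h1 h2
    omega
  obtain ⟨i, hi⟩ := main
  have hs := sum_rotate (fun j => max (u j) (v j)) i
  refine ⟨i, fun j => min (u j) (v j), ?_⟩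
  rcases hi with ⟨a, b, c⟩ | ⟨a, b, c⟩
  · left
    constructor <;> omega
  · right
    constructor <;> omega

lemma le_of_baryTriangle_subset {u v : Fin 3 → ℤ} (hu : u 0 + u 1 + u 2 ≤ 0)
    (h : baryTriangle u ⊆ baryTriangle v) : v ≤ u := by
  intro i
  have hs := sum_rotate u i
  have := h (mem_baryTriangle_rowCell (i := i) (d := u i) (m := u (i + 1)).2 (by omega))
  exact (mem_baryTriangle_rowCell.1 this).1

/-- A partition of `P` into sets that build triangles. -/
structure IsBuildingPartition (P : Finset (ℤ × ℤ)) (F : Finset (Finset (ℤ × ℤ))) : Prop where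
  disjoint : ∀ B ∈ F, ∀ C ∈ F, B ≠ C → Disjoint B C
  mem_iff : ∀ p, p ∈ P ↔ ∃ B ∈ F, p ∈ B
  builds : ∀ B ∈ F, ∃ u, Builds B u

/-- Merging parts as long as possible leaves no two parts with touching triangles. -/
lemma exists_isBuildingPartition (P : Finset (ℤ × ℤ)) : ∃ F, IsBuildingPartition P F ∧
    ∀ B ∈ F, ∀ C ∈ F, B ≠ C → ∀ u v, Builds B u → Builds C v → gap u v ≠ 1 := by
  classical
  have hex : ∃ k, ∃ F, IsBuildingPartition P F ∧ F.card = k := by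
    refine ⟨_, P.image fun p => {p}, ⟨?_, ?_, ?_⟩, rfl⟩
    · intro B hB C hC hBC
      obtain ⟨p, -, rfl⟩ := Finset.mem_image.1 hB
      obtain ⟨q, -, rfl⟩ := Finset.mem_image.1 hC
      rw [Finset.disjoint_singleton]
      rintro rfl
      exact hBC rfl
    · intro p
      simp only [Finset.mem_image, exists_exists_and_eq_and, Finset.mem_singleton]
      exact ⟨fun hp => ⟨p, hp, rfl⟩, fun ⟨q, hq, e⟩ => e ▸ hq⟩
    · intro B hB
      obtain ⟨p, -, rfl⟩ := Finset.mem_image.1 hB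
      exact ⟨_, Builds.single p⟩
  obtain ⟨F, hF, hk⟩ := Nat.find_spec hex
  refine ⟨F, hF, fun B hB C hC hBC u v hu hv hgap => ?_⟩
  have cB := hu.card
  have cC := hv.card
  have pB := Finset.card_pos.2 hu.nonempty
  have pC := Finset.card_pos.2 hv.nonempty
  have hBC' : ∃ x, Builds (B ∪ C) x := by
    obtain ⟨i, x, h | h⟩ := exists_isMerge_of_gap_eq_one (by omega) (by omega) hgap
    · exact ⟨x, Builds.merge i hu hv h⟩
    · exact ⟨x, Finset.union_comm C B ▸ Builds.merge i hv hu h⟩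
  set G := (F.erase B).erase C with hG
  have memG : ∀ D, D ∈ G ↔ D ≠ C ∧ D ≠ B ∧ D ∈ F := fun D => by
    rw [hG, Finset.mem_erase, Finset.mem_erase]
  have cG : G.card + 2 = F.card := by
    have h1 := Finset.card_erase_add_one hB
    have h2 := Finset.card_erase_add_one (Finset.mem_erase.2 ⟨hBC.symm, hC⟩)
    rw [hG]
    omega
  have hdis : ∀ D ∈ G, Disjoint D (B ∪ C) := fun D hD => by
    obtain ⟨h1, h2, h3⟩ := (memG D).1 hD
    exact Finset.disjoint_union_right.2 ⟨hF.disjoint D h3 B hB h2, hF.disjoint D h3 C hC h1⟩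
  refine Nat.find_min hex (m := (insert (B ∪ C) G).card) ?_ ⟨_, ⟨?_, ?_, ?_⟩, rfl⟩
  · rw [← hk]
    have := Finset.card_insert_le (B ∪ C) G
    omega
  · intro D hD E hE hDE
    rcases Finset.mem_insert.1 hD with rfl | hD <;> rcases Finset.mem_insert.1 hE with rfl | hE
    · exact absurd rfl hDE
    · exact (hdis E hE).symm
    · exact hdis D hD
    · exact hF.disjoint D ((memG D).1 hD).2.2 E ((memG E).1 hE).2.2 hDE
  · intro p
    rw [hF.mem_iff]
    constructor
    · rintro ⟨D, hD, hp⟩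
      by_cases h1 : D = B
      · exact ⟨B ∪ C, Finset.mem_insert_self _ _, Finset.mem_union_left _ (h1 ▸ hp)⟩
      by_cases h2 : D = C
      · exact ⟨B ∪ C, Finset.mem_insert_self _ _, Finset.mem_union_right _ (h2 ▸ hp)⟩
      exact ⟨D, Finset.mem_insert_of_mem ((memG D).2 ⟨h2, h1, hD⟩), hp⟩
    · rintro ⟨D, hD, hp⟩
      rcases Finset.mem_insert.1 hD with rfl | hD
      · rcases Finset.mem_union.1 hp with hp | hp
        · exact ⟨B, hB, hp⟩
        · exact ⟨C, hC, hp⟩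
      · exact ⟨D, ((memG D).1 hD).2.2, hp⟩
  · intro D hD
    rcases Finset.mem_insert.1 hD with rfl | hD
    · exact hBC'
    · exact hF.builds D ((memG D).1 hD).2.2

/-- Disjoint subsets of a basis cannot build intersecting triangles: a common cell could be given
two different symbols. -/
lemma IsTriangleBasis.gap_pos [Nontrivial A] (hR : IsTEP R) {n : ℕ} {P : Set (ℤ × ℤ)}
    (h : IsTriangleBasis R n P) {B C : Finset (ℤ × ℤ)} {u v : Fin 3 → ℤ} (hB : Builds B u)
    (hC : Builds C v) (hBC : Disjoint B C) (hBP : (B : Set (ℤ × ℤ)) ⊆ P)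
    (hCP : (C : Set (ℤ × ℤ)) ⊆ P) : 0 < gap u v := by
  classical
  by_contra hgap
  obtain ⟨p, hpu, hpv⟩ := exists_mem_of_gap_nonpos (not_lt.1 hgap)
  obtain ⟨a, b, hab⟩ := exists_pair_ne A
  obtain ⟨t₁, h₁, e₁⟩ := hR.exists_isConfig_apply_eq p a
  obtain ⟨t₂, h₂, e₂⟩ := hR.exists_isConfig_apply_eq p b
  let c : P → A := fun q => if (q : ℤ × ℤ) ∈ B then t₁ q else t₂ q
  obtain ⟨t, -, ht⟩ := h c
  have d₁ : Deduces R c p (t₁ p) := by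
    refine hB.baryTriangle_subset (isWindowClosed_deduces c h₁) (fun q hq => ?_) hpu
    have := Deduces.base (R := R) (c := c) ⟨q, hBP hq⟩
    rwa [show c ⟨q, hBP hq⟩ = t₁ q from if_pos hq] at this
  have d₂ : Deduces R c p (t₂ p) := by
    refine hC.baryTriangle_subset (isWindowClosed_deduces c h₂) (fun q hq => ?_) hpv
    have := Deduces.base (R := R) (c := c) ⟨q, hCP hq⟩
    rwa [show c ⟨q, hCP hq⟩ = t₂ q from if_neg (Finset.disjoint_right.1 hBC hq)] at this
  rw [e₁] at d₁
  rw [e₂] at d₂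
  exact hab (((ht p a).1 d₁).2.trans ((ht p b).1 d₂).2.symm)

lemma finite_triangle (n : ℕ) : (triangle n).Finite :=
  (Set.finite_Icc ((0 : ℤ), (0 : ℤ)) ((n : ℤ), (n : ℤ))).subset fun p hp => by
    obtain ⟨h1, h2, h3⟩ := hp
    exact ⟨⟨h1, h2⟩, ⟨by simp only; omega, by simp only; omega⟩⟩

/-- The triangle is connected through windows. -/
lemma triangle_subset_of_step {n : ℕ} {D : Set (ℤ × ℤ)} (h0 : (0, 0) ∈ D)
    (hD : ∀ v ∈ D, ∀ k : Fin 3, v + windowCell k ∈ triangle n → v + windowCell k ∈ D) :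
    triangle n ⊆ D := by
  have hx : ∀ x : ℕ, ((x : ℤ), (0 : ℤ)) ∈ triangle n → ((x : ℤ), (0 : ℤ)) ∈ D := by
    intro x
    induction x with
    | zero => exact fun _ => h0
    | succ x ih =>
      intro hm
      have e : (((x + 1 : ℕ) : ℤ), (0 : ℤ)) = ((x : ℤ), (0 : ℤ)) + windowCell 1 := by
        simp [windowCell]
      have hm' : ((x : ℤ), (0 : ℤ)) ∈ triangle n := by
        obtain ⟨h1, h2, h3⟩ := hm
        refine ⟨by simp, by simp, ?_⟩
        push_cast at h3 ⊢
        omega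
      rw [e] at hm ⊢
      exact hD _ (ih hm') 1 hm
  have hxy : ∀ y x : ℕ, ((x : ℤ), (y : ℤ)) ∈ triangle n → ((x : ℤ), (y : ℤ)) ∈ D := by
    intro y x
    induction y with
    | zero => exact hx x
    | succ y ih =>
      intro hm
      have e : ((x : ℤ), ((y + 1 : ℕ) : ℤ)) = ((x : ℤ), (y : ℤ)) + windowCell 2 := by
        simp [windowCell]
      have hm' : ((x : ℤ), (y : ℤ)) ∈ triangle n := by
        obtain ⟨h1, h2, h3⟩ := hm
        refine ⟨by simp, by simp, ?_⟩
        push_cast at h3 ⊢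
        omega
      rw [e] at hm ⊢
      exact hD _ (ih hm') 2 hm
  rintro ⟨x, y⟩ hm
  have h1 : 0 ≤ x := hm.1
  have h2 : 0 ≤ y := hm.2.1
  lift x to ℕ using h1
  lift y to ℕ using h2
  exact hxy y x hm

/-- A basis builds the triangle: once no more parts can be merged, the triangles of the parts are
pairwise apart, so their union is closed under deduction and equals the connected set `T_n`. -/
theorem IsTriangleBasis.exists_builds [Nontrivial A] (hR : IsTEP R) {n : ℕ} (hn : 1 ≤ n)
    {P : Set (ℤ × ℤ)} (h : IsTriangleBasis R n P) :
    ∃ Q : Finset (ℤ × ℤ), (Q : Set (ℤ × ℤ)) = P ∧ Builds Q ![1 - (n : ℤ), 0, 0] := by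
  classical
  obtain ⟨a₀⟩ : Nonempty A := inferInstance
  obtain ⟨t₀, ht₀, -⟩ := hR.exists_isConfig_apply_eq (0, 0) a₀
  obtain ⟨t, -, ht⟩ := h fun p => t₀ p
  have hPT : P ⊆ triangle n := fun p hp => ((ht p _).1 (Deduces.base ⟨p, hp⟩)).1
  obtain ⟨Q, rfl⟩ := ((finite_triangle n).subset hPT).exists_finset_coe
  refine ⟨Q, rfl, ?_⟩
  obtain ⟨F, hF, hgap⟩ := exists_isBuildingPartition Q
  choose! U hU using hF.builds
  have hsub : ∀ B ∈ F, (B : Set (ℤ × ℤ)) ⊆ Q := fun B hB p hp => (hF.mem_iff p).2 ⟨B, hB, hp⟩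
  have hpos : ∀ B ∈ F, ∀ C ∈ F, B ≠ C → 2 ≤ gap (U B) (U C) := by
    intro B hB C hC hBC
    have h1 := hgap B hB C hC hBC _ _ (hU B hB) (hU C hC)
    have h2 := h.gap_pos hR (hU B hB) (hU C hC) (hF.disjoint B hB C hC hBC) (hsub B hB) (hsub C hC)
    omega
  have hwin : ∀ B ∈ F, ∀ C ∈ F, ∀ v j k, v + windowCell j ∈ baryTriangle (U B) →
      v + windowCell k ∈ baryTriangle (U C) → B = C := by
    intro B hB C hC v j k h1 h2
    by_contra hBC
    have := hpos B hB C hC hBC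
    have := gap_le_one_of_window h1 h2
    omega
  have hclosed : IsWindowClosed {p | ∃ B ∈ F, p ∈ baryTriangle (U B)} := by
    intro v k hv
    obtain ⟨j, hj⟩ : ∃ j : Fin 3, j ≠ k := exists_ne k
    obtain ⟨B, hB, hjB⟩ := hv j hj
    refine ⟨B, hB, isWindowClosed_baryTriangle _ v k fun i hi => ?_⟩
    obtain ⟨C, hC, hiC⟩ := hv i hi
    rwa [hwin B hB C hC v j i hjB hiC]
  have hcover : triangle n ⊆ {p | ∃ B ∈ F, p ∈ baryTriangle (U B)} := fun p hp =>
    ((ht p _).2 ⟨hp, rfl⟩).mem hclosed fun q hq => by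
      obtain ⟨B, hB, hqB⟩ := (hF.mem_iff q).1 hq
      exact ⟨B, hB, (hU B hB).subset hqB⟩
  have hle : ∀ B ∈ F, baryTriangle (U B) ⊆ triangle n := fun B hB => by
    rw [triangle_eq_baryTriangle]
    refine (hU B hB).baryTriangle_subset (isWindowClosed_baryTriangle _) ?_
    rw [← triangle_eq_baryTriangle]
    exact (hsub B hB).trans hPT
  obtain ⟨B, hB, h0B⟩ := hcover (show ((0, 0) : ℤ × ℤ) ∈ triangle n from
    ⟨le_rfl, le_rfl, by simp only; omega⟩)
  have hTB : triangle n ⊆ baryTriangle (U B) := by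
    refine triangle_subset_of_step h0B fun v hv k hk => ?_
    obtain ⟨C, hC, hkC⟩ := hcover hk
    have hv0 : v + windowCell 0 ∈ baryTriangle (U B) := by
      change v + (0 : ℤ × ℤ) ∈ _
      rwa [add_zero]
    rwa [hwin B hB C hC v 0 k hv0 hkC]
  have hFB : ∀ C ∈ F, C = B := by
    intro C hC
    by_contra hCB
    obtain ⟨p, hp⟩ := (hU C hC).nonempty
    have hpC := (hU C hC).subset hp
    have := gap_nonpos_of_mem hpC (hTB (hle C hC hpC))
    have := hpos C hC B hB hCB
    omega
  have hQB : Q = B := by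
    ext p
    rw [hF.mem_iff]
    exact ⟨fun ⟨C, hC, hp⟩ => hFB C hC ▸ hp, fun hp => ⟨B, hB, hp⟩⟩
  have cB := (hU B hB).card
  have pB := Finset.card_pos.2 (hU B hB).nonempty
  have hUB : U B = ![1 - (n : ℤ), 0, 0] := by
    have h1 := hle B hB
    rw [triangle_eq_baryTriangle] at h1 hTB
    refine le_antisymm (le_of_baryTriangle_subset ?_ hTB) (le_of_baryTriangle_subset (by omega) h1)
    simp
    omega
  rw [hQB, ← hUB]
  exact hU B hB

end Basis

/-! ### From `3`-permutations to families of three orders -/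

section Transport

variable {X Y : Type*} [DecidableEq X]

lemma invCount_image {a b : X → ℕ} {c : Y → X} {T : Finset Y} (hc : Set.InjOn c T) (y : Y) :
    invCount a b (T.image c) (c y) = invCount (fun z => a (c z)) (fun z => b (c z)) T y := by
  unfold invCount
  rw [Finset.filter_image, Finset.card_image_of_injOn]
  exact hc.mono (by exact_mod_cast Finset.filter_subset _ _)

lemma IsTriFamily.comp {o : Fin 3 → X → ℕ} {c : Y → X} {T : Finset Y} (hc : Set.InjOn c T)
    (H : IsTriFamily o (T.image c)) : IsTriFamily (fun j y => o j (c y)) T := by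
  have m : ∀ y ∈ T, c y ∈ T.image c := fun y hy => Finset.mem_image_of_mem c hy
  refine ⟨fun x hx y hy e => ?_, fun x hx y hy e => ?_, fun x hx y hy e => ?_, ?_, ?_⟩
  · exact hc hx hy (H.injf (m x hx) (m y hy) e)
  · exact hc hx hy (H.injg (m x hx) (m y hy) e)
  · exact hc hx hy (H.injh (m x hx) (m y hy) e)
  · exact fun x hx y hy => H.not_unanimous _ (m x hx) _ (m y hy)
  · exact fun x hx y hy z hz => H.not_cyclic _ (m x hx) _ (m y hy) _ (m z hz)

/-- Every other element is an inversion of `p` for exactly one cyclically consecutive pair of the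
three orders. -/
lemma IsTriOrder.sum_invCount {f g h : Y → ℕ} {S : Finset Y} (H : IsTriOrder f g h S) {p : Y}
    (hp : p ∈ S) :
    invCount f g S p + invCount h f S p + invCount g h S p + 1 = S.card := by
  classical
  have key : ∀ j ∈ S, ((if f p < f j ∧ g j < g p then 1 else 0) +
      (if h p < h j ∧ f j < f p then 1 else 0) + (if g p < g j ∧ h j < h p then 1 else 0) +
      (if j = p then 1 else 0) : ℕ) = 1 := by
    intro j hj
    by_cases e : j = p
    · subst e
      simp
    · have h1 : f j ≠ f p := fun h => e (H.injf hj hp h)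
      have h2 : g j ≠ g p := fun h => e (H.injg hj hp h)
      have h3 : h j ≠ h p := fun h => e (H.injh hj hp h)
      have h4 := H.not_unanimous j hj p hp
      have h5 := H.not_unanimous p hp j hj
      split_ifs <;> omega
  have hsum := Finset.sum_congr (rfl : S = S) key
  simp only [Finset.sum_add_distrib, ← Finset.card_filter] at hsum
  rw [Finset.filter_eq' S p, if_pos hp, Finset.card_singleton] at hsum
  unfold invCount
  rw [hsum]
  simp

end Transport

section ThreePermutations

variable {n : ℕ}

/-- The three orders on positions given by a `3`-permutation: those of its two components, and
between them the natural order. -/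
def triOrders (p : ThreePerm n) : Fin 3 → Fin n → ℕ :=
  ![fun i => p.1 i, fun i => i, fun i => p.2 i]

lemma contains_pattern12_iff (p : ThreePerm n) :
    p.Contains pattern12 ↔ ∃ i j, i < j ∧ p.1 i < p.1 j ∧ p.2 i < p.2 j := by
  constructor
  · rintro ⟨e, he⟩
    have h01 : (0 : Fin 2) < 1 := by decide
    exact ⟨e 0, e 1, e.lt_iff_lt.2 h01, (he 0 1).1.2 h01, (he 0 1).2.2 h01⟩
  · rintro ⟨i, j, h, h1, h2⟩
    have hm : StrictMono ![i, j] := by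
      intro a b hab
      fin_cases a <;> fin_cases b <;> simp_all
    refine ⟨OrderEmbedding.ofStrictMono _ hm, fun a b => ?_⟩
    fin_cases a <;> fin_cases b <;> simp [pattern12, h1, h2, h1.le, h2.le]

lemma contains_pattern312_iff (p : ThreePerm n) :
    p.Contains pattern312 ↔ ∃ i j k, (i < j ∧ j < k) ∧ (p.1 j < p.1 k ∧ p.1 k < p.1 i) ∧
      (p.2 k < p.2 i ∧ p.2 i < p.2 j) := by
  constructor
  · rintro ⟨e, he⟩
    refine ⟨e 0, e 1, e 2, ⟨e.lt_iff_lt.2 (by decide), e.lt_iff_lt.2 (by decide)⟩,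
      ⟨(he 1 2).1.2 (by decide), (he 2 0).1.2 (by decide)⟩,
      (he 2 0).2.2 (by decide), (he 0 1).2.2 (by decide)⟩
  · rintro ⟨i, j, k, ⟨h1, h2⟩, ⟨h3, h4⟩, h5, h6⟩
    have hm : StrictMono ![i, j, k] := by
      have h12 := h1.trans h2
      intro a b hab
      fin_cases a <;> fin_cases b <;> simp_all
    have h34 := h3.trans h4
    have h56 := h5.trans h6
    refine ⟨OrderEmbedding.ofStrictMono _ hm, fun a b => ?_⟩
    fin_cases a <;> fin_cases b <;>
      simp [pattern312, perm312, perm231, h3, h4, h5, h6, h34, h56, h3.le, h4.le, h5.le, h6.le,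
        h34.le, h56.le]

lemma mem_avoiders_iff (p : ThreePerm n) :
    p ∈ avoiders n ↔ IsTriFamily (triOrders p) Finset.univ := by
  have hinj : ∀ ρ : Equiv.Perm (Fin n),
      Set.InjOn (fun i => (ρ i : ℕ)) (Finset.univ : Finset (Fin n)) :=
    fun ρ x _ y _ e => ρ.injective (Fin.ext e)
  change ¬ _ ∧ ¬ _ ↔ _
  rw [contains_pattern12_iff, contains_pattern312_iff]
  constructor
  · rintro ⟨h1, h2⟩
    refine ⟨hinj 1, hinj p.1, hinj p.2, ?_, ?_⟩
    · rintro i - j - ⟨h, h', h''⟩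
      exact h1 ⟨i, j, h, h', h''⟩
    · rintro i - j - k - ⟨h, h', h''⟩
      exact h2 ⟨i, j, k, h, h', h''⟩
  · intro H
    constructor
    · rintro ⟨i, j, h, h', h''⟩
      exact H.not_unanimous i (Finset.mem_univ _) j (Finset.mem_univ _) ⟨h, h', h''⟩
    · rintro ⟨i, j, k, h, h', h''⟩
      exact H.not_cyclic i (Finset.mem_univ _) j (Finset.mem_univ _) k (Finset.mem_univ _)
        ⟨h, h', h''⟩

/-- The point of `Γ` at position `i`. -/
def gamPoint (p : ThreePerm n) (i : Fin n) : ℤ × ℤ := (rightInv p.1 i, leftInv p.2 i)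

lemma triCount_one (p : ThreePerm n) (i : Fin n) :
    triCount (triOrders p) Finset.univ 1 i = rightInv p.1 i := rfl

lemma triCount_two (p : ThreePerm n) (i : Fin n) :
    triCount (triOrders p) Finset.univ 2 i = leftInv p.2 i := by
  unfold triCount invCount leftInv
  congr 1
  ext j
  simp only [Finset.mem_filter]
  exact and_congr_right fun _ => and_comm

lemma isPlaced_gamPoint {p : ThreePerm n} (H : IsTriFamily (triOrders p) Finset.univ) (i : Fin n) :
    IsPlaced (triOrders p) Finset.univ ![1 - (n : ℤ), 0, 0] i (gamPoint p i) := by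
  have hs := IsTriOrder.sum_invCount H (Finset.mem_univ i)
  change triCount (triOrders p) Finset.univ 1 i + triCount (triOrders p) Finset.univ 2 i +
    triCount (triOrders p) Finset.univ 0 i + 1 = _ at hs
  rw [triCount_one, triCount_two, Finset.card_univ, Fintype.card_fin] at hs
  intro j
  fin_cases j
  · change -(rightInv p.1 i : ℤ) - leftInv p.2 i =
      (triCount (triOrders p) Finset.univ 0 i : ℤ) + (1 - n)
    omega
  · change (rightInv p.1 i : ℤ) = (triCount (triOrders p) Finset.univ 1 i : ℤ) + 0
    rw [triCount_one, add_zero]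
  · change (leftInv p.2 i : ℤ) = (triCount (triOrders p) Finset.univ 2 i : ℤ) + 0
    rw [triCount_two, add_zero]

lemma coe_image_gamPoint (p : ThreePerm n) :
    ((Finset.univ.image (gamPoint p) : Finset (ℤ × ℤ)) : Set (ℤ × ℤ)) = Gam p := by
  rw [Finset.coe_image, Finset.coe_univ, Set.image_univ]
  rfl

lemma builds_of_mem_avoiders (hn : 1 ≤ n) {p : ThreePerm n} (hp : p ∈ avoiders n) :
    Builds (Finset.univ.image (gamPoint p)) ![1 - (n : ℤ), 0, 0] := by
  have H := (mem_avoiders_iff p).1 hp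
  refine H.builds ⟨⟨0, hn⟩, Finset.mem_univ _⟩ ?_ _ fun i _ => isPlaced_gamPoint H i
  simp

lemma gamPoint_injective (hn : 1 ≤ n) {p : ThreePerm n} (hp : p ∈ avoiders n) :
    Function.Injective (gamPoint p) := by
  have h := (builds_of_mem_avoiders hn hp).card
  have h' : (Finset.univ.image (gamPoint p)).card = (Finset.univ : Finset (Fin n)).card := by
    rw [Finset.card_univ, Fintype.card_fin]
    simp at h
    omega
  have := Finset.card_image_iff.1 h'
  rwa [Finset.coe_univ, Set.injOn_univ] at this

lemma perm_eq_of_lt_iff {σ σ' : Equiv.Perm (Fin n)} (h : ∀ a b, σ a < σ b ↔ σ' a < σ' b) :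
    σ = σ' := by
  have hm : StrictMono fun a => σ' (σ.symm a) := fun a b hab => by
    rw [← h]
    simpa using hab
  refine Equiv.ext fun a => ?_
  have h2 := congrFun hm.eq_id (σ a)
  simp only [Equiv.symm_apply_apply, id] at h2
  exact h2.symm

theorem injOn_gam (hn : 1 ≤ n) : Set.InjOn (Gam (n := n)) (avoiders n) := by
  classical
  intro p hp p' hp' e
  have hne : Nonempty (Fin n) := ⟨⟨0, hn⟩⟩
  have B := builds_of_mem_avoiders hn hp
  have hc := gamPoint_injective hn hp
  have hc' := gamPoint_injective hn hp'
  have himg : Finset.univ.image (gamPoint p) = Finset.univ.image (gamPoint p') := by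
    rw [← Finset.coe_inj, coe_image_gamPoint, coe_image_gamPoint, e]
  -- The orders of a `3`-permutation, transported to the points of its image under `Γ`.
  have placed : ∀ q ∈ avoiders n, ∀ r ∈ Finset.univ.image (gamPoint q),
      IsPlaced (fun j r => triOrders q j (Function.invFun (gamPoint q) r))
        (Finset.univ.image (gamPoint q)) ![1 - (n : ℤ), 0, 0] r r := by
    intro q hq r hr
    obtain ⟨i, -, rfl⟩ := Finset.mem_image.1 hr
    intro j
    have hi := isPlaced_gamPoint ((mem_avoiders_iff q).1 hq) i j
    have hinv := Function.leftInverse_invFun (gamPoint_injective hn hq)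
    rw [hi]
    unfold triCount
    rw [invCount_image (gamPoint_injective hn hq).injOn]
    simp only [hinv _]
  have uniq := B.order_unique (placed p hp) (by rw [himg]; exact placed p' hp')
  have hinv := Function.leftInverse_invFun hc
  have hinv' := Function.leftInverse_invFun hc'
  let φ : Fin n → Fin n := fun a => Function.invFun (gamPoint p') (gamPoint p a)
  have hφ : ∀ a, gamPoint p' (φ a) = gamPoint p a := fun a => by
    have : gamPoint p a ∈ Finset.univ.image (gamPoint p') :=
      himg ▸ Finset.mem_image_of_mem _ (Finset.mem_univ a)
    obtain ⟨b, -, hb⟩ := Finset.mem_image.1 this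
    change gamPoint p' (Function.invFun (gamPoint p') (gamPoint p a)) = _
    rw [← hb, hinv' b]
  have huniq : ∀ j a b, triOrders p j a < triOrders p j b ↔
      triOrders p' j (φ a) < triOrders p' j (φ b) := fun j a b => by
    have := uniq j _ (Finset.mem_image_of_mem _ (Finset.mem_univ a)) _
      (Finset.mem_image_of_mem _ (Finset.mem_univ b))
    simpa only [hinv _] using this
  have hφm : StrictMono φ := fun a b hab => (huniq 1 a b).1 hab
  rw [hφm.eq_id] at huniq
  exact Prod.ext (perm_eq_of_lt_iff fun a b => huniq 0 a b)
    (perm_eq_of_lt_iff fun a b => huniq 2 a b)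

/-- A building set is the image under `Γ` of the `3`-permutation given by the ranks of its cells in
the three orders read off it. -/
theorem exists_mem_avoiders_of_builds {Q : Finset (ℤ × ℤ)} (B : Builds Q ![1 - (n : ℤ), 0, 0]) :
    ∃ p ∈ avoiders n, Gam p = Q := by
  classical
  obtain ⟨o, ho⟩ := B.exists_isReading
  have hcard : Q.card = n := by
    have := B.card
    simp at this
    omega
  have hinj : ∀ i, Set.InjOn (o i) Q := fun i => ((isTriFamily_iff i).1 ho.family).injf
  -- The ranks of the cells of `Q` in each order are `0, …, n - 1`.
  have hbij : ∀ i, Function.Bijective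
      fun q : Q => (⟨o i q, hcard ▸ ho.rank_lt i q q.2⟩ : Fin n) := by
    intro i
    rw [Fintype.bijective_iff_injective_and_card]
    refine ⟨fun a b e => Subtype.ext (hinj i a.2 b.2 (Fin.mk.inj e)), ?_⟩
    rw [Fintype.card_coe, hcard, Fintype.card_fin]
  let E : Fin 3 → Q ≃ Fin n := fun i => Equiv.ofBijective _ (hbij i)
  have hE : ∀ i q, ((E i q : Fin n) : ℕ) = o i q := fun i q => rfl
  let c : Fin n → ℤ × ℤ := fun k => (E 1).symm k
  have hc : Function.Injective c := Subtype.val_injective.comp (E 1).symm.injective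
  have himg : Finset.univ.image c = Q := by
    ext r
    simp only [Finset.mem_image, Finset.mem_univ, true_and]
    constructor
    · rintro ⟨k, rfl⟩
      exact ((E 1).symm k).2
    · intro hr
      exact ⟨E 1 ⟨r, hr⟩, by simp [c]⟩
  let p : ThreePerm n := ((E 1).symm.trans (E 0), (E 1).symm.trans (E 2))
  have hp : triOrders p = fun j k => o j (c k) := by
    funext j k
    fin_cases j
    · exact hE 0 _
    · change (k : ℕ) = o 1 ((E 1).symm k)
      rw [← hE 1, Equiv.apply_symm_apply]
    · exact hE 2 _
  refine ⟨p, ?_, ?_⟩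
  · rw [mem_avoiders_iff, hp]
    refine IsTriFamily.comp hc.injOn ?_
    rw [himg]
    exact ho.family
  · have hpt : gamPoint p = c := by
      funext k
      have hk := ho.placed (c k) ((E 1).symm k).2
      have hcount : ∀ j, triCount o Q j (c k) = triCount (triOrders p) Finset.univ j k := by
        intro j
        unfold triCount
        rw [hp, ← himg, invCount_image hc.injOn]
      have h1 := hk 1
      have h2 := hk 2
      rw [hcount, triCount_one] at h1
      rw [hcount, triCount_two] at h2
      simp only [bary_one, bary_two] at h1 h2
      ext
      · simpa [gamPoint] using h1.symm
      · simpa [gamPoint] using h2.symm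
    rw [← coe_image_gamPoint, hpt, himg]

theorem bijOn_gam {A : Type*} [Nontrivial A] {R : Set (Fin 3 → A)} (hR : IsTEP R) (hn : 1 ≤ n) :
    Set.BijOn (Gam (n := n)) (avoiders n) {P | IsTriangleBasis R n P} := by
  refine ⟨fun p hp => ?_, injOn_gam hn, fun P hP => ?_⟩
  · rw [← coe_image_gamPoint]
    exact (builds_of_mem_avoiders hn hp).isTriangleBasis hR
  · obtain ⟨Q, rfl, hQ⟩ := IsTriangleBasis.exists_builds hR hn hP
    obtain ⟨p, hp, e⟩ := exists_mem_avoiders_of_builds hQ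
    exact ⟨p, hp, e⟩

lemma isTEP_ledrappier : IsTEP ledrappier := by
  have key : ∀ (k : Fin 3) (x y z : ZMod 2), ∃ a : ZMod 2, ∀ b : ZMod 2,
      Function.update ![x, y, z] k b 0 + Function.update ![x, y, z] k b 1 +
        Function.update ![x, y, z] k b 2 = 0 ↔ b = a := by decide
  intro k w
  obtain ⟨a, ha⟩ := key k (w 0) (w 1) (w 2)
  have hw : ![w 0, w 1, w 2] = w := by
    funext j
    fin_cases j <;> rfl
  rw [hw] at ha
  exact ⟨a, (ha a).2 rfl, fun b hb => (ha b).1 hb⟩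

end ThreePermutations

/-- For `n ≥ 1`, `Γ` is a bijection from `Av_n((12,12), (312,231))` onto the bases of `T_n`, for
the Ledrappier subshift and, more generally, for every TEP rule on at least two symbols. -/
theorem mainTheorem1 (n : ℕ) (hn : 1 ≤ n) :
    Set.BijOn (Gam (n := n)) (avoiders n) {P | IsTriangleBasis ledrappier n P} ∧
    ∀ (A : Type*) [Nontrivial A] (R : Set (Fin 3 → A)), IsTEP R →
      Set.BijOn (Gam (n := n)) (avoiders n) {P | IsTriangleBasis R n P} :=
  ⟨bijOn_gam isTEP_ledrappier hn, fun _ _ _ hR => bijOn_gam hR hn⟩
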